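/- Let $\mathcal A$ be a complex algebra, not necessarily unital, and $\varphi:\mathcal A\to\mathbb C$ a linear functional (with $\varphi(1)=1$ if $\mathcal A$ is unital). Let $\widetilde{\mathcal C}=\mathbb C1\oplus\mathcal C$ denote the unitization of an algebra $\mathcal C$, let $*$ be the free product of unital algebras with identification of units, and $\sqcup$ the free product without identification of units. *Conditional bi-freeness.* For $\chi:\{1,\dots,n\}\to\{\ell,r\}$ order $\{1,\dots,n\}$ by $\prec_\chi$: first the elements of $\chi^{-1}(\ell)$ increasingly, then those of $\chi^{-1}(r)$ decreasingly. For $\omega:\{1,\dots,n\}\to K$ let $\pi_{\chi,\omega}$ be the partition of $\{1,\dots,n\}$ into the maximal $\prec_\chi$-intervals on which $\omega$ is constant. For $V=\{v_1<\dots<v_s\}$ put $c_V=c_{v_1}\cdots c_{v_s}$. Pairs $(\mathcal B_{k,\ell},\mathcal B_{k,r})_{k\in K}$ of unital subalgebras of a unital algebra with unital linear functionals $\Phi,\Psi$ are c-bi-free with respect to $(\Phi,\Psi)$ if, for all $n\ge1$, $\chi$, $\omega$ and $c_j\in\mathcal B_{\omega(j),\chi(j)}$ such that $\Psi(c_V)=0$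 for every $V\in\pi_{\chi,\omega}$, one has $\Psi(c_1\cdots c_n)=0$ and $\Phi(c_1\cdots c_n)=\prod_{V\in\pi_{\chi,\omega}}\Phi(c_V)$. The c-bi-free product of pairs of unital functionals $(\varphi_k,\psi_k)$ on $\mathcal B_{k,\ell}*\mathcal B_{k,r}$ is the pair $(\Phi,\Psi)$ of unital functionals on $*_{k}(\mathcal B_{k,\ell}*\mathcal B_{k,r})$ that restricts to $(\varphi_k,\psi_k)$ for each $k$ and with respect to which the pairs $(\mathcal B_{k,\ell},\mathcal B_{k,r})$ are c-bi-free. *Bi-monotonic independence (type I).* Given pairs of algebras $(\mathcal A_{k,\ell},\mathcal A_{k,r})$, $k=1,2$, and linear functionals $\varphi_k$ on $\mathcal A_{k,\ell}\sqcup\mathcal A_{k,r}$, let $\widetilde{\varphi_k}$ be the unital extension of $\varphi_k$ to $\widetilde{\mathcal A_{k,\ell}}*\widetilde{\mathcal A_{k,r}}$, the unitization of $\mathcal A_{k,\ell}\sqcup\mathcal A_{k,r}$, and let $\delta_1$ be the character of $\widetilde{\mathcal A_{1,\ell}}*\widetilde{\mathcal A_{1,r}}$ that vanishes on $\mathcal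 A_{1,\ell}\sqcup\mathcal A_{1,r}$. The bi-monotonic product of $\varphi_1$ and $\varphi_2$ is the restriction to $(\mathcal A_{1,\ell}\sqcup\mathcal A_{1,r})\sqcup(\mathcal A_{2,\ell}\sqcup\mathcal A_{2,r})$ of the first coordinate of the c-bi-free product of $(\widetilde{\varphi_1},\delta_1)$ and $(\widetilde{\varphi_2},\widetilde{\varphi_2})$. Pairs $(a_1,b_1)$, $(a_2,b_2)$ of elements of $\mathcal A$ are bi-monotonically independent (in this order) if, for $\mathcal A_{k,\ell}$ and $\mathcal A_{k,r}$ the (non-unital) subalgebras of $\mathcal A$ generated by $a_k$ and by $b_k$, the functional that $\varphi$ induces on $(\mathcal A_{1,\ell}\sqcup\mathcal A_{1,r})\sqcup(\mathcal A_{2,\ell}\sqcup\mathcal A_{2,r})$ through the canonical homomorphism to $\mathcal A$ is the bi-monotonic product of the functionals it induces on $\mathcal A_{1,\ell}\sqcup\mathcal A_{1,r}$ and $\mathcal A_{2,\ell}\sqcup\mathcal A_{2,r}$. *Transforms.* With $\varphi(a^0b^0)=1$, put, as formal series in $1/z,1/w$, $$G_a(z)=\sum_{m\ge0}\frac{\varphi(a^m)}{z^{m+1}},\qquad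 F_a(z)=\frac1{G_a(z)},\qquad G_{(a,b)}(z,w)=\sum_{m,n\ge0}\frac{\varphi(a^mb^n)}{z^{m+1}w^{n+1}}.$$ For $X\in M_2(\mathcal A)$ and an invertible $2\times2$ matrix $B$ such that the entries of $B^{-1}$ are formal power series without constant term, put $G_X(B)=\sum_{n\ge0}M_2(\varphi)\big(B^{-1}(XB^{-1})^n\big)$ (where $\varphi(1)=1$ in the unitization) and $F_X(B)=G_X(B)^{-1}$. **Theorem.** Let $(a_1,b_1)$ and $(a_2,b_2)$ be bi-monotonically independent (of type I, in this order) with respect to $\varphi$. Then, in the fraction field of $\mathbb C[[1/z,1/w]]$, $$G_{(a_1+a_2,b_1+b_2)}(z,w)=G_{(a_1,b_1)}(F_{a_2}(z),F_{b_2}(w))\,G_{(a_2,b_2)}(z,w)\,F_{a_2}(z)\,F_{b_2}(w),$$ together with $F_{a_1+a_2}(z)=F_{a_1}(F_{a_2}(z))$ and $F_{b_1+b_2}(w)=F_{b_1}(F_{b_2}(w))$. Moreover, with $X_j=\begin{bmatrix}a_j&0\\0&b_j\end{bmatrix}$ and indeterminates $z,w,\zeta$, over the fraction field of $\mathbb C[[1/z,1/w,\zeta]]$,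 $$F_{X_1+X_2}\left(\begin{bmatrix}z&\zeta\\0&w\end{bmatrix}\right)=F_{X_1}\left(F_{X_2}\left(\begin{bmatrix}z&\zeta\\0&w\end{bmatrix}\right)\right).$$ -/

import Mathlib

/-- Sum of a (locally finite) family of formal power series, taken coefficientwise. -/
noncomputable def MvPowerSeries.formalSum {σ ι R : Type*} [Semiring R]
    (f : ι → MvPowerSeries σ R) : MvPowerSeries σ R :=
  fun d => ∑ᶠ i, MvPowerSeries.coeff d (f i)

namespace BiMonotone

/-- The two faces of a pair of algebras. -/
inductive Face
  | left
  | right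
deriving DecidableEq

open Face

/-! ### The order `≺_χ`, the partition `π_{χ,ω}`, and ordered products -/

/-- `i ≼_χ j`: the left positions come first, in increasing order, and are followed by the
right positions in decreasing order. -/
def chiLE {n : ℕ} (χ : Fin n → Face) (i j : Fin n) : Prop :=
  (χ i = left ∧ χ j = right) ∨ (χ i = left ∧ χ j = left ∧ i ≤ j) ∨
    (χ i = right ∧ χ j = right ∧ j ≤ i)

instance {n : ℕ} (χ : Fin n → Face) : DecidableRel (chiLE χ) := fun i j => by
  unfold chiLE; infer_instance

/-- `i` and `j` lie in a common `χ`-interval on which `ω` is constant. -/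
def SameBlock {K : Type*} {n : ℕ} (χ : Fin n → Face) (ω : Fin n → K) (i j : Fin n) : Prop :=
  ∀ k : Fin n, (chiLE χ i k ∧ chiLE χ k j) ∨ (chiLE χ j k ∧ chiLE χ k i) →
    ω k = ω i ∧ ω k = ω j

instance {K : Type*} [DecidableEq K] {n : ℕ} (χ : Fin n → Face) (ω : Fin n → K) :
    DecidableRel (SameBlock χ ω) := fun i j => by
  unfold SameBlock; infer_instance

/-- The partition `π_{χ,ω}` of the positions into the maximal `χ`-intervals on which `ω` is
constant (so that `ω` takes different values on `≺_χ`-consecutive blocks). -/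
def blocks {K : Type*} [DecidableEq K] {n : ℕ} (χ : Fin n → Face) (ω : Fin n → K) :
    Finset (Finset (Fin n)) :=
  Finset.univ.image fun i => Finset.univ.filter fun j => SameBlock χ ω i j

/-- `a_V = a_{v₁} ⋯ a_{v_s}` for `V = {v₁ < ⋯ < v_s}`. -/
def subProd {B : Type*} [Monoid B] {n : ℕ} (a : Fin n → B) (V : Finset (Fin n)) : B :=
  (((List.finRange n).filter fun i => i ∈ V).map a).prod

/-! ### Conditional bi-freeness -/

/-- Conditional bi-free independence of the pairs of unital algebras `(S k left, S k right)` with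
respect to `(Φ, Ψ)`: if every block `V` of `π_{χ,ω}` satisfies `Ψ(a_V) = 0`, then
`Ψ(a₁ ⋯ aₙ) = 0` and `Φ(a₁ ⋯ aₙ) = ∏_V Φ(a_V)`. -/
def CBiFree {K B : Type*} [DecidableEq K] [Semiring B] [Algebra ℂ B]
    (Φ Ψ : B →ₗ[ℂ] ℂ) (S : K → Face → Subalgebra ℂ B) : Prop :=
  ∀ (n : ℕ), 1 ≤ n → ∀ (χ : Fin n → Face) (ω : Fin n → K) (a : Fin n → B),
    (∀ j, a j ∈ S (ω j) (χ j)) →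
    (∀ V ∈ blocks χ ω, Ψ (subProd a V) = 0) →
    Ψ (List.ofFn a).prod = 0 ∧
      Φ (List.ofFn a).prod = ∏ V ∈ blocks χ ω, Φ (subProd a V)

section Products

variable {K : Type*} [DecidableEq K]

/-- The free product `*_k (B_{k,ℓ} * B_{k,r})` of unital algebras, units identified. -/
abbrev FullFree (B : K → Face → Type*) [∀ k c, Ring (B k c)] [∀ k c, Algebra ℂ (B k c)] : Type _ :=
  LinearAlgebra.FreeProduct ℂ (fun i : K × Face => B i.1 i.2)

/-- The free product `B_{k,ℓ} * B_{k,r}` of unital algebras, units identified. -/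
abbrev PairFree (B : Face → Type*) [∀ c, Ring (B c)] [∀ c, Algebra ℂ (B c)] : Type _ :=
  LinearAlgebra.FreeProduct ℂ B

/-- The canonical map `B_{k,ℓ} * B_{k,r} → *_k (B_{k,ℓ} * B_{k,r})`. -/
noncomputable def pairIncl (B : K → Face → Type*) [∀ k c, Ring (B k c)]
    [∀ k c, Algebra ℂ (B k c)] (k : K) : PairFree (B k) →ₐ[ℂ] FullFree B :=
  LinearAlgebra.FreeProduct.lift ℂ (B k)
    (fun {c} => LinearAlgebra.FreeProduct.ι ℂ (fun i : K × Face => B i.1 i.2) (k, c))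

/-- `(Φ, Ψ)` is the c-bi-free product of the pairs of unital functionals `(φ k, ψ k)`. -/
structure IsCBiFreeProduct (B : K → Face → Type*) [∀ k c, Ring (B k c)]
    [∀ k c, Algebra ℂ (B k c)] (φ ψ : ∀ k, PairFree (B k) →ₗ[ℂ] ℂ)
    (Φ Ψ : FullFree B →ₗ[ℂ] ℂ) : Prop where
  restrict_fst : ∀ k, Φ ∘ₗ (pairIncl B k).toLinearMap = φ k
  restrict_snd : ∀ k, Ψ ∘ₗ (pairIncl B k).toLinearMap = ψ k
  cBiFree : CBiFree Φ Ψ fun k c =>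
    (LinearAlgebra.FreeProduct.ι ℂ (fun i : K × Face => B i.1 i.2) (k, c)).range

end Products

/-! ### The bi-monotonic product and bi-monotonic independence (of type I) -/

/-- The delta functional of the unitization of `A_ℓ ⊔ A_r`, this unitization being identified
with the free product of the unitizations of `A_ℓ` and `A_r`: it is the character that kills
`A_ℓ` and `A_r`. -/
noncomputable def delta (A : Face → Type*) [∀ c, NonUnitalRing (A c)] [∀ c, Module ℂ (A c)]
    [∀ c, SMulCommClass ℂ (A c) (A c)] [∀ c, IsScalarTower ℂ (A c) (A c)] :
    PairFree (fun c => Unitization ℂ (A c)) →ₗ[ℂ] ℂ :=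
  (LinearAlgebra.FreeProduct.lift ℂ (fun c => Unitization ℂ (A c))
    (fun {c} => Unitization.fstHom ℂ (A c))).toLinearMap

/-- `Φ` is the bi-monotonic product of `φ 0` and `φ 1` (in this order). Linear functionals on a
free product `⊔` without identification of units are represented by their unital extensions to
the unitization, i.e. to the free product of the unitizations. The product is the first
coordinate of the c-bi-free product of `(φ 0, δ)` and `(φ 1, φ 1)`. -/
def IsBiMonotonicProduct (A : Fin 2 → Face → Type*) [∀ k c, NonUnitalRing (A k c)]
    [∀ k c, Module ℂ (A k c)] [∀ k c, SMulCommClass ℂ (A k c) (A k c)]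
    [∀ k c, IsScalarTower ℂ (A k c) (A k c)]
    (φ : ∀ k, PairFree (fun c => Unitization ℂ (A k c)) →ₗ[ℂ] ℂ)
    (Φ : FullFree (fun k c => Unitization ℂ (A k c)) →ₗ[ℂ] ℂ) : Prop :=
  ∃ Ψ, IsCBiFreeProduct (fun k c => Unitization ℂ (A k c)) φ
    (fun k => if k = 0 then delta (A k) else φ k) Φ Ψ

section Space

variable {A : Type*} [NonUnitalRing A] [Module ℂ A] [SMulCommClass ℂ A A] [IsScalarTower ℂ A A]

/-- The unital linear extension of `φ` to the unitization of `A`. -/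
noncomputable def unitalExt (φ : A →ₗ[ℂ] ℂ) : Unitization ℂ A →ₗ[ℂ] ℂ :=
  (Unitization.fstHom ℂ A).toLinearMap + φ ∘ₗ Unitization.sndHom ℂ ℂ A

/-- The joint distribution of a family of subalgebras with respect to `φ`: the (unital extension
of the) functional that `φ` induces on the free product of the family through the canonical
homomorphism into `A`. -/
noncomputable def jointDistribution {J : Type*} [DecidableEq J] (φ : A →ₗ[ℂ] ℂ)
    (S : J → NonUnitalSubalgebra ℂ A) :
    LinearAlgebra.FreeProduct ℂ (fun j => Unitization ℂ (S j)) →ₗ[ℂ] ℂ :=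
  unitalExt φ ∘ₗ
    (LinearAlgebra.FreeProduct.lift ℂ (fun j => Unitization ℂ (S j))
      (fun {j} => Unitization.lift ((Unitization.inrNonUnitalAlgHom ℂ A).comp
        (NonUnitalSubalgebraClass.subtype (S j))))).toLinearMap

/-- Bi-monotonic independence (type I) of the pairs of algebras `(S 0 left, S 0 right)` and
`(S 1 left, S 1 right)`, in this order: their joint distribution is the bi-monotonic product of
the distributions of the two pairs. -/
def BiMonotonicallyIndependent (φ : A →ₗ[ℂ] ℂ) (S : Fin 2 → Face → NonUnitalSubalgebra ℂ A) :
    Prop :=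
  IsBiMonotonicProduct (fun k c => S k c) (fun k => jointDistribution φ (S k))
    (jointDistribution φ fun i : Fin 2 × Face => S i.1 i.2)

/-- The pair of (non-unital) algebras generated by the pair of elements `(a, b)`. -/
def generatedPair (a b : A) : Face → NonUnitalSubalgebra ℂ A
  | left => NonUnitalAlgebra.adjoin ℂ {a}
  | right => NonUnitalAlgebra.adjoin ℂ {b}

/-- Bi-monotonic independence (type I) of the pairs of elements `(a₁, b₁)`, `(a₂, b₂)`. -/
def BiMonotonicPairs (φ : A →ₗ[ℂ] ℂ) (a₁ b₁ a₂ b₂ : A) : Prop :=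
  BiMonotonicallyIndependent φ ![generatedPair a₁ b₁, generatedPair a₂ b₂]

/-- The joint moment `φ(a^m b^n)`, equal to `1` for `m = n = 0`. -/
noncomputable def moment (φ : A →ₗ[ℂ] ℂ) (a b : A) (m n : ℕ) : ℂ :=
  unitalExt φ ((a : Unitization ℂ A) ^ m * (b : Unitization ℂ A) ^ n)

end Space

/-! ### Formal transforms

The quantities `z`, `w`, `F_a(z)`, … are elements of the fraction field of a ring of formal power
series, the variables of the power series ring playing the role of `1/z`, `1/w`, … -/

/-- The fraction field of `ℂ[[x_i : i ∈ σ]]`. -/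
abbrev FormalField (σ : Type*) : Type _ := FractionRing (MvPowerSeries σ ℂ)

open scoped Classical in
/-- An element of the fraction field that is a power series without constant term, as such a
power series (and `0` for all other elements). -/
noncomputable def toSeries {σ : Type*} (x : FormalField σ) : MvPowerSeries σ ℂ :=
  if h : ∃ p : MvPowerSeries σ ℂ, MvPowerSeries.constantCoeff p = 0 ∧
      algebraMap (MvPowerSeries σ ℂ) (FormalField σ) p = x
  then h.choose else 0

section Transforms

variable {A : Type*} [NonUnitalRing A] [Module ℂ A] [SMulCommClass ℂ A A] [IsScalarTower ℂ A A]
  {σ : Type*}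

/-- `G_a(Z) = ∑_m φ(a^m) / Z^(m+1)`, for `Z` such that `1/Z` is a power series without constant
term. -/
noncomputable def cauchy (φ : A →ₗ[ℂ] ℂ) (a : A) (Z : FormalField σ) : FormalField σ :=
  algebraMap (MvPowerSeries σ ℂ) (FormalField σ) <|
    MvPowerSeries.formalSum fun m : ℕ => moment φ a 0 m 0 • toSeries Z⁻¹ ^ (m + 1)

/-- `F_a = 1 / G_a`. -/
noncomputable def recCauchy (φ : A →ₗ[ℂ] ℂ) (a : A) (Z : FormalField σ) : FormalField σ :=
  (cauchy φ a Z)⁻¹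

/-- `G_{(a,b)}(Z, W) = ∑_{m,n} φ(a^m b^n) / (Z^(m+1) W^(n+1))`, for `Z`, `W` such that `1/Z` and
`1/W` are power series without constant term. -/
noncomputable def cauchy₂ (φ : A →ₗ[ℂ] ℂ) (a b : A) (Z W : FormalField σ) : FormalField σ :=
  algebraMap (MvPowerSeries σ ℂ) (FormalField σ) <|
    MvPowerSeries.formalSum fun p : ℕ × ℕ =>
      moment φ a b p.1 p.2 • (toSeries Z⁻¹ ^ (p.1 + 1) * toSeries W⁻¹ ^ (p.2 + 1))

/-- `φ` applied to the coefficients of a power series over the unitization of `A`. -/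
noncomputable def mapFunctional (φ : A →ₗ[ℂ] ℂ) (f : MvPowerSeries σ (Unitization ℂ A)) :
    MvPowerSeries σ ℂ :=
  fun d => unitalExt φ (MvPowerSeries.coeff d f)

/-- The `M₂(ℂ)`-valued Cauchy transform `G_X(B) = M₂(φ)((B - X)⁻¹)` of `X ∈ M₂(A)`, given by
its expansion `∑_n M₂(φ)(B⁻¹ (X B⁻¹)^n)`, for invertible `B` such that the entries of `B⁻¹` are
power series without constant term. -/
noncomputable def matCauchy (φ : A →ₗ[ℂ] ℂ) (X : Matrix (Fin 2) (Fin 2) A)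
    (B : Matrix (Fin 2) (Fin 2) (FormalField σ)) : Matrix (Fin 2) (Fin 2) (FormalField σ) :=
  let X' : Matrix (Fin 2) (Fin 2) (MvPowerSeries σ (Unitization ℂ A)) :=
    X.map fun x => MvPowerSeries.C (x : Unitization ℂ A)
  let C : Matrix (Fin 2) (Fin 2) (MvPowerSeries σ (Unitization ℂ A)) :=
    B⁻¹.map fun x => MvPowerSeries.map (algebraMap ℂ (Unitization ℂ A)) (toSeries x)
  Matrix.of fun i j => algebraMap (MvPowerSeries σ ℂ) (FormalField σ) <|
    MvPowerSeries.formalSum fun n : ℕ => mapFunctional φ ((C * (X' * C) ^ n) i j)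

/-- The `M₂(ℂ)`-valued `F`-transform `F_X(B) = G_X(B)⁻¹`. -/
noncomputable def matRecCauchy (φ : A →ₗ[ℂ] ℂ) (X : Matrix (Fin 2) (Fin 2) A)
    (B : Matrix (Fin 2) (Fin 2) (FormalField σ)) : Matrix (Fin 2) (Fin 2) (FormalField σ) :=
  (matCauchy φ X B)⁻¹

end Transforms

/-- The variable `x_i`, as an element of the fraction field. -/
noncomputable def var {σ : Type*} (i : σ) : FormalField σ :=
  algebraMap (MvPowerSeries σ ℂ) (FormalField σ) (MvPowerSeries.X i)

end BiMonotone

/-! The mixed moments that matter are those of words $y_0xy_1x\cdots xy_k\cdot y'_0x'y'_1x'\cdots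
x'y'_l$, where $x,x'$ are the left and right letters of the first pair and $y_i,y'_i$ lie in the
left and right algebras of the second. In the order $\prec_\chi$ the right positions are reversed,
so the two final slots $y_k$ and $y'_l$ are neighbours and form a single block, while every other
slot is isolated by letters $x$ or $x'$. The second functional is $\delta$ on the first pair and
vanishes on any block containing $x$ or $x'$. Hence c-bi-freeness applies once the slots are
centered, and centering slot by slot gives (`CBiFree.moment_formula`)
$$\Phi=\prod_{i<k}\Phi(y_i)\prod_{i<l}\Phi(y'_i)\;\Phi(x^kx'^l)\;\Phi(y_ky'_l).$$

Splitting $(a_1+a_2)^m$ at the first occurrence of $a_1$ turns this into a renewal recursion: each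
factor $a_1$ is accompanied by an independent $\varphi(a_2^i)$. Its solution (`seriesEval_renewal`)
replaces $u=1/z$ by $U=u\sum_i\varphi(a_2^i)u^i=1/F_{a_2}(z)$. The same holds on the right, with
$v=1/w$ replaced by $V=1/F_{b_2}(w)$. Writing $M_j$ for the generating series of
$\varphi(a_j^mb_j^n)$ and $M$ for that of the sums, the outcome is `BiMonotonicPairs.biEval_moment`:
$M(u,v)=M_1(U,V)\,M_2(u,v)$.

All assertions follow from this identity. The two-variable formula is a rewriting of it, and the
one-variable formulas are its restrictions to $v=0$ and $u=0$. For the matrix formula, if $B^{-1}$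
is upper triangular with diagonal $u,v$ and corner $s$, then $G_X(B)$ is upper triangular with the
scalar Cauchy transforms on the diagonal and corner $M(u,v)s$ (`matCauchy_eq`). Composition
multiplies the corner factors exactly as in the identity. -/

namespace BiMonotone

open Face

/-! ### Alternating words and their χ-order -/

section Blocks

variable {B : Type*}

/-- The sequence `y₀ x y₁ x ⋯ x y_k y'₀ x' y'₁ x' ⋯`, in which the first `2 k + 1` terms alternate
between the `y i` and `x`, and the other ones alternate between the `y' i` and `x'`. -/
def alternating (k : ℕ) (y : ℕ → B) (x : B) (y' : ℕ → B) (x' : B) (i : ℕ) : B :=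
  if i < 2 * k + 1 then (if i % 2 = 0 then y (i / 2) else x)
  else (if (i - (2 * k + 1)) % 2 = 0 then y' ((i - (2 * k + 1)) / 2) else x')

/-- The first `2 k + 1` positions are left positions, the other ones are right positions. -/
def faceAt (k i : ℕ) : Face := if i < 2 * k + 1 then left else right

theorem prod_alternating_aux [Monoid B] (y : ℕ → B) (x : B) (k : ℕ) :
    ((List.range (2 * k + 1)).map fun i => if i % 2 = 0 then y (i / 2) else x).prod =
      ((List.range k).map fun i => y i * x).prod * y k := by
  induction k with
  | zero => simp
  | succ k ih =>
    rw [show 2 * (k + 1) + 1 = 2 * k + 1 + 1 + 1 by ring, List.range_succ, List.range_succ,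
      List.map_append, List.map_append, List.prod_append, List.prod_append, ih, List.range_succ,
      List.map_append, List.prod_append]
    have h1 : (2 * k + 1) % 2 ≠ 0 := by omega
    have h2 : (2 * k + 1 + 1) % 2 = 0 := by omega
    have h3 : (2 * k + 1 + 1) / 2 = k + 1 := by omega
    simp [h2, h3, mul_assoc]

theorem alternating_even {k i : ℕ} (hi : i ≤ k) (y y' : ℕ → B) (x x' : B) :
    alternating k y x y' x' (2 * i) = y i := by
  rw [alternating, if_pos (by omega), if_pos (by omega)]; congr 1; omega

theorem alternating_odd {k i : ℕ} (hi : i < k) (y y' : ℕ → B) (x x' : B) :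
    alternating k y x y' x' (2 * i + 1) = x := by
  rw [alternating, if_pos (by omega), if_neg (by omega)]

theorem alternating_add_even (k i : ℕ) (y y' : ℕ → B) (x x' : B) :
    alternating k y x y' x' (2 * k + 1 + 2 * i) = y' i := by
  rw [alternating, if_neg (by omega), if_pos (by omega)]; congr 1; omega

theorem alternating_add_odd (k i : ℕ) (y y' : ℕ → B) (x x' : B) :
    alternating k y x y' x' (2 * k + 1 + (2 * i + 1)) = x' := by
  rw [alternating, if_neg (by omega), if_neg (by omega)]

theorem prod_alternating [Monoid B] (k l : ℕ) (y y' : ℕ → B) (x x' : B) :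
    (List.ofFn fun i : Fin (2 * k + 1 + (2 * l + 1)) => alternating k y x y' x' i).prod =
      ((List.range k).map fun i => y i * x).prod * y k *
        (((List.range l).map fun i => y' i * x').prod * y' l) := by
  have e : (List.ofFn fun i : Fin (2 * k + 1 + (2 * l + 1)) => alternating k y x y' x' i) =
      (List.range (2 * k + 1 + (2 * l + 1))).map (alternating k y x y' x') := by
    apply List.ext_getElem <;> simp [-List.ofFn_succ]
  rw [e, List.range_add, List.map_append, List.prod_append, ← prod_alternating_aux,
    ← prod_alternating_aux, List.map_map]
  congr 2
  · refine List.map_congr_left fun i hi => ?_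
    rw [alternating, if_pos (List.mem_range.1 hi)]
  · refine List.map_congr_left fun i hi => ?_
    rw [Function.comp, alternating, if_neg (by omega), Nat.add_sub_cancel_left]

/-- Reduces all questions about blocks to linear arithmetic on positions. Since right positions are
reversed, position `2 * k` is followed immediately by the last position of the word. -/
theorem chiLE_faceAt {k n : ℕ} (i j : Fin n) :
    chiLE (fun i : Fin n => faceAt k i) i j ↔
      (i.1 < 2 * k + 1 ∧ 2 * k + 1 ≤ j.1) ∨ (j.1 < 2 * k + 1 ∧ i.1 ≤ j.1) ∨
        (2 * k + 1 ≤ i.1 ∧ j.1 ≤ i.1 ∧ 2 * k + 1 ≤ j.1) := by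
  unfold chiLE faceAt
  by_cases hi : i.1 < 2 * k + 1 <;> by_cases hj : j.1 < 2 * k + 1 <;>
    simp [hi, hj] <;> omega

theorem subProd_singleton [Monoid B] {n : ℕ} (a : Fin n → B) (i : Fin n) :
    subProd a {i} = a i := by
  have : (List.finRange n).filter (fun j => j ∈ ({i} : Finset (Fin n))) = [i] := by
    apply List.Perm.eq_of_pairwise (le := (· < ·))
    · intro a b _ _ h1 h2; exact absurd h1 (not_lt.2 h2.le)
    · exact (List.pairwise_lt_finRange n).filter _
    · simp
    · rw [List.perm_ext_iff_of_nodup ((List.nodup_finRange n).filter _) (by simp)]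
      simp
  simp only [subProd, this]; simp

theorem subProd_pair [Monoid B] {n : ℕ} (a : Fin n → B) {i j : Fin n} (hij : i < j) :
    subProd a {i, j} = a i * a j := by
  have : (List.finRange n).filter (fun c => c ∈ ({i, j} : Finset (Fin n))) = [i, j] := by
    apply List.Perm.eq_of_pairwise (le := (· < ·))
    · intro a b _ _ h1 h2; exact absurd h1 (not_lt.2 h2.le)
    · exact (List.pairwise_lt_finRange n).filter _
    · simpa using hij
    · rw [List.perm_ext_iff_of_nodup ((List.nodup_finRange n).filter _) (by simpa using hij.ne)]
      simp
  simp only [subProd, this]; simp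

end Blocks

/-! ### Mixed moments under conditional bi-freeness -/

section Moments

variable {B : Type*} [Ring B] [Algebra ℂ B] {Φ Ψ : B →ₗ[ℂ] ℂ}
  {S : Fin 2 → Face → Subalgebra ℂ B} {x x' : B}

/-- The mixed moments that vanish by conditional bi-freeness: `m i = 0` marks the trivial `y i`, and
the two middle elements `y k`, `y' l` carry the same mark. -/
theorem CBiFree.alternating_eq_zero (hC : CBiFree Φ Ψ S)
    (hx : x ∈ S 0 left) (hx' : x' ∈ S 0 right)
    (h0 : ∀ L : List B, (∀ e ∈ L, e = 1 ∨ e = x ∨ e = x') → (x ∈ L ∨ x' ∈ L) → Ψ L.prod = 0)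
    (h1 : ∀ y ∈ S 1 left, ∀ y' ∈ S 1 right, Ψ (y * y') = Φ (y * y'))
    (k l : ℕ) (y y' : ℕ → B) (m m' : ℕ → Fin 2)
    (hy : ∀ i, y i ∈ S 1 left) (hy' : ∀ i, y' i ∈ S 1 right)
    (hm : ∀ i, m i = 0 → y i = 1) (hm' : ∀ i, m' i = 0 → y' i = 1)
    (hc : ∀ i < k, m i = 1 → Φ (y i) = 0) (hc' : ∀ i < l, m' i = 1 → Φ (y' i) = 0)
    (hmid : m k = m' l) (hcmid : m k = 1 → Φ (y k * y' l) = 0)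
    (hex : (∃ i ≤ k, m i = 1) ∨ (∃ i ≤ l, m' i = 1)) :
    Φ (((List.range k).map fun i => y i * x).prod * y k *
        (((List.range l).map fun i => y' i * x').prod * y' l)) = 0 := by
  classical
  rw [← prod_alternating]
  set n := 2 * k + 1 + (2 * l + 1) with hn
  set a : Fin n → B := fun i => alternating k y x y' x' i with ha
  set χ : Fin n → Face := fun i => faceAt k i with hχ
  set ω : Fin n → Fin 2 := fun i => alternating k m 0 m' 0 i with hω
  have two : ∀ t : Fin 2, t = 0 ∨ t = 1 := by decide
  have hyΨ : ∀ i, Ψ (y i) = Φ (y i) := fun i => by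
    simpa using h1 _ (hy i) 1 (one_mem _)
  have hyΨ' : ∀ i, Ψ (y' i) = Φ (y' i) := fun i => by
    simpa using h1 1 (one_mem _) _ (hy' i)
  have hsame : ∀ {i j : Fin n}, SameBlock χ ω i j → ω j = ω i := by
    intro i j h
    refine (h j ?_).1
    simp only [hχ, chiLE_faceAt]; omega
  have hrefl : ∀ i : Fin n, SameBlock χ ω i i := by
    intro i c hc
    have : c = i := by
      simp only [hχ, chiLE_faceAt] at hc; apply Fin.ext; omega
    subst this; simp
  -- the letters with label `0`
  have hzero : ∀ i : Fin n, ω i = 0 → a i = 1 ∨ a i = x ∨ a i = x' := by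
    intro i hi
    simp only [hω, ha, alternating] at hi ⊢
    split_ifs at hi ⊢
    · exact Or.inl (hm _ hi)
    · simp
    · exact Or.inl (hm' _ hi)
    · simp
  have hmem : ∀ j, a j ∈ S (ω j) (χ j) := by
    intro j
    simp only [hω, ha, hχ, alternating, faceAt]
    split_ifs
    · rcases two (m (j.1 / 2)) with h | h
      · rw [hm _ h]; exact one_mem _
      · rw [h]; exact hy _
    · exact hx
    · rcases two (m' ((j.1 - (2 * k + 1)) / 2)) with h | h
      · rw [hm' _ h]; exact one_mem _
      · rw [h]; exact hy' _
    · exact hx'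
  have hblock0 : ∀ i : Fin n, ω i = 0 →
      Ψ (subProd a (Finset.univ.filter fun j => SameBlock χ ω i j)) = 0 := by
    intro i hi
    -- A trivial slot carries label `0`, so it merges with the letters `x`, `x'` around it. The
    -- block must contain such a letter and not only units, because `Ψ 1` need not vanish.
    have key : ∃ j : Fin n, SameBlock χ ω i j ∧ (a j = x ∨ a j = x') := by
      have hx1 : ∀ (c : Fin n) (i : ℕ), i < k → c.1 = 2 * i + 1 → ω c = 0 ∧ a c = x :=
        fun c i hi hc => by
          constructor
          · change alternating _ _ _ _ _ _ = _; rw [hc, alternating_odd hi]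
          · change alternating _ _ _ _ _ _ = _; rw [hc, alternating_odd hi]
      have hx2 : ∀ (c : Fin n) (i : ℕ), c.1 = 2 * k + 1 + (2 * i + 1) → ω c = 0 ∧ a c = x' :=
        fun c i hc => by
          constructor
          · change alternating _ _ _ _ _ _ = _; rw [hc, alternating_add_odd]
          · change alternating _ _ _ _ _ _ = _; rw [hc, alternating_add_odd]
      have hadj : ∀ j : Fin n, ω j = 0 →
          (∀ c : Fin n, (chiLE χ i c ∧ chiLE χ c j) ∨ (chiLE χ j c ∧ chiLE χ c i) →
            c = i ∨ c = j ∨ ω c = 0) → SameBlock χ ω i j := by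
        intro j hj h c hc
        rcases h c hc with rfl | rfl | h <;> simp_all
      have hk1 : ω ⟨2 * k, by omega⟩ = m k := alternating_even le_rfl _ _ _ _
      have hk2 : ω ⟨2 * k + 1 + 2 * l, by omega⟩ = m' l := alternating_add_even _ _ _ _ _ _
      have hkl : ω i = 0 → (i.1 = 2 * k ∨ i.1 = 2 * k + 1 + 2 * l) → m k = 0 ∧ m' l = 0 := by
        rintro hi (h | h)
        · rw [show i = ⟨2 * k, by omega⟩ from Fin.ext h, hk1] at hi
          exact ⟨hi, hmid ▸ hi⟩
        · rw [show i = ⟨2 * k + 1 + 2 * l, by omega⟩ from Fin.ext h, hk2] at hi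
          exact ⟨hmid.trans hi, hi⟩
      have hne : ω i = 0 → (i.1 = 2 * k ∨ i.1 = 2 * k + 1 + 2 * l) → 0 < k ∨ 0 < l := by
        intro hi h
        by_contra! hcon
        obtain ⟨hk0, hl0⟩ := hkl hi h
        rcases hex with ⟨t, ht, h⟩ | ⟨t, ht, h⟩
        · rw [show t = k by omega, hk0] at h; exact absurd h (by decide)
        · rw [show t = l by omega, hl0] at h; exact absurd h (by decide)
      have hin := i.2
      by_cases hil : i.1 < 2 * k + 1
      · by_cases hodd : i.1 % 2 = 1
        · exact ⟨i, hrefl i, Or.inl (hx1 i (i.1 / 2) (by omega) (by omega)).2⟩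
        by_cases hik : i.1 < 2 * k
        · have := hx1 ⟨i.1 + 1, by omega⟩ (i.1 / 2) (by omega) (by simp only; omega)
          refine ⟨_, hadj _ this.1 fun c hc => ?_, Or.inl this.2⟩
          simp only [hχ, chiLE_faceAt] at hc
          simp only [Fin.ext_iff]; omega
        -- For the last left slot with `k = 0` there is no `x` at all. The nearest letter is then
        -- the last `x'`, reached across the equally trivial slot `y' l`; `hex` guarantees `0 < l`.
        rcases Nat.eq_zero_or_pos k with hk | hk
        · have hl := hne hi (by omega)
          have := hx2 ⟨2 * k + 1 + (2 * (l - 1) + 1), by omega⟩ (l - 1) rfl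
          refine ⟨_, hadj _ this.1 fun c hc => ?_, Or.inr this.2⟩
          simp only [hχ, chiLE_faceAt] at hc
          by_cases hcl : c.1 = 2 * k + 1 + 2 * l
          · right; right
            rw [show c = ⟨2 * k + 1 + 2 * l, by omega⟩ from Fin.ext hcl, hk2]
            exact (hkl hi (by omega)).2
          · simp only [Fin.ext_iff]; omega
        · have := hx1 ⟨i.1 - 1, by omega⟩ (k - 1) (by omega) (by simp only; omega)
          refine ⟨_, hadj _ this.1 fun c hc => ?_, Or.inl this.2⟩
          simp only [hχ, chiLE_faceAt] at hc
          simp only [Fin.ext_iff]; omega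
      · by_cases hodd : (i.1 - (2 * k + 1)) % 2 = 1
        · exact ⟨i, hrefl i, Or.inr (hx2 i ((i.1 - (2 * k + 1)) / 2) (by omega)).2⟩
        by_cases hik : i.1 < 2 * k + 1 + 2 * l
        · have := hx2 ⟨i.1 + 1, by omega⟩ ((i.1 - (2 * k + 1)) / 2) (by simp only; omega)
          refine ⟨_, hadj _ this.1 fun c hc => ?_, Or.inr this.2⟩
          simp only [hχ, chiLE_faceAt] at hc
          simp only [Fin.ext_iff]; omega
        rcases Nat.eq_zero_or_pos l with hl | hl
        · have hk := hne hi (by omega)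
          have := hx1 ⟨2 * (k - 1) + 1, by omega⟩ (k - 1) (by omega) rfl
          refine ⟨_, hadj _ this.1 fun c hc => ?_, Or.inl this.2⟩
          simp only [hχ, chiLE_faceAt] at hc
          by_cases hcl : c.1 = 2 * k
          · right; right
            rw [show c = ⟨2 * k, by omega⟩ from Fin.ext hcl, hk1]
            exact (hkl hi (by omega)).1
          · simp only [Fin.ext_iff]; omega
        · have := hx2 ⟨i.1 - 1, by omega⟩ (l - 1) (by simp only; omega)
          refine ⟨_, hadj _ this.1 fun c hc => ?_, Or.inr this.2⟩
          simp only [hχ, chiLE_faceAt] at hc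
          simp only [Fin.ext_iff]; omega
    obtain ⟨j, hj, hjx⟩ := key
    refine h0 _ ?_ ?_
    · intro e he
      simp only [List.mem_map, List.mem_filter, Finset.mem_filter, decide_eq_true_eq] at he
      obtain ⟨c, hc, rfl⟩ := he
      exact hzero c ((hsame hc.2.2).trans hi)
    · have hjm : a j ∈ ((List.finRange n).filter fun c =>
          c ∈ Finset.univ.filter fun j => SameBlock χ ω i j).map a := by
        apply List.mem_map_of_mem
        simp [hj]
      rcases hjx with h | h
      · left; rwa [← h]
      · right; rwa [← h]
  -- A block of label `1` is a single centered slot, or the pair formed by the two final slots, on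
  -- whose product `Φ` vanishes. On both kinds `Ψ` agrees with `Φ`.
  have hblock1 : ∀ i : Fin n, ω i = 1 →
      Ψ (subProd a (Finset.univ.filter fun j => SameBlock χ ω i j)) = 0 ∧
      Φ (subProd a (Finset.univ.filter fun j => SameBlock χ ω i j)) = 0 := by
    intro i hi
    have hin := i.2
    have hx1 : ∀ c : Fin n, c.1 < 2 * k + 1 → c.1 % 2 = 1 → ω c = 0 := fun c h1 h2 => by
      change alternating _ _ _ _ _ _ = _
      rw [show c.1 = 2 * (c.1 / 2) + 1 by omega, alternating_odd (by omega)]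
    have hx2 : ∀ c : Fin n, ¬ c.1 < 2 * k + 1 → (c.1 - (2 * k + 1)) % 2 = 1 → ω c = 0 :=
      fun c h1 h2 => by
        change alternating _ _ _ _ _ _ = _
        rw [show c.1 = 2 * k + 1 + (2 * ((c.1 - (2 * k + 1)) / 2) + 1) by omega,
          alternating_add_odd]
    have hsep : ∀ j c : Fin n, ω c = 0 →
        ((chiLE χ i c ∧ chiLE χ c j) ∨ (chiLE χ j c ∧ chiLE χ c i)) → ¬ SameBlock χ ω i j := by
      intro j c hc hcj h
      have := (h c hcj).1
      rw [hc, hi] at this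
      exact absurd this (by decide)
    have hsing : (∀ j, SameBlock χ ω i j → j = i) →
        (Finset.univ.filter fun j => SameBlock χ ω i j) = {i} := by
      intro h
      ext j
      simp only [Finset.mem_filter, Finset.mem_univ, true_and, Finset.mem_singleton]
      exact ⟨h j, fun hj => hj ▸ hrefl i⟩
    by_cases hil : i.1 < 2 * k
    · have heven : i.1 % 2 = 0 := by
        by_contra hodd
        rw [hx1 i (by omega) (by omega)] at hi; exact absurd hi (by decide)
      have it : i.1 = 2 * (i.1 / 2) := by omega
      have ea : a i = y (i.1 / 2) := by
        change alternating _ _ _ _ _ _ = _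
        conv_lhs => rw [it]
        exact alternating_even (by omega) _ _ _ _
      have eω : ω i = m (i.1 / 2) := by
        change alternating _ _ _ _ _ _ = _
        conv_lhs => rw [it]
        exact alternating_even (by omega) _ _ _ _
      have h := hc (i.1 / 2) (by omega) (eω.symm.trans hi)
      rw [hsing, subProd_singleton, ea, hyΨ, h]
      · simp
      · intro j hj
        by_contra hne
        rw [Fin.ext_iff] at hne
        by_cases hji : j.1 < i.1
        · refine hsep j ⟨i.1 - 1, by omega⟩ (hx1 _ (by simp only; omega) (by simp only; omega))
            ?_ hj
          simp only [hχ, chiLE_faceAt]; omega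
        · refine hsep j ⟨i.1 + 1, by omega⟩ (hx1 _ (by simp only; omega) (by simp only; omega))
            ?_ hj
          simp only [hχ, chiLE_faceAt]; omega
    by_cases hir : 2 * k + 1 ≤ i.1 ∧ i.1 < 2 * k + 1 + 2 * l
    · have heven : (i.1 - (2 * k + 1)) % 2 = 0 := by
        by_contra hodd
        rw [hx2 i (by omega) (by omega)] at hi; exact absurd hi (by decide)
      have it : i.1 = 2 * k + 1 + 2 * ((i.1 - (2 * k + 1)) / 2) := by omega
      have ea : a i = y' ((i.1 - (2 * k + 1)) / 2) := by
        change alternating _ _ _ _ _ _ = _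
        conv_lhs => rw [it]
        exact alternating_add_even _ _ _ _ _ _
      have eω : ω i = m' ((i.1 - (2 * k + 1)) / 2) := by
        change alternating _ _ _ _ _ _ = _
        conv_lhs => rw [it]
        exact alternating_add_even _ _ _ _ _ _
      have h := hc' ((i.1 - (2 * k + 1)) / 2) (by omega) (eω.symm.trans hi)
      rw [hsing, subProd_singleton, ea, hyΨ', h]
      · simp
      · intro j hj
        by_contra hne
        rw [Fin.ext_iff] at hne
        by_cases hji : 2 * k + 1 ≤ j.1 ∧ j.1 < i.1
        · refine hsep j ⟨i.1 - 1, by omega⟩ (hx2 _ (by simp only; omega) (by simp only; omega))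
            ?_ hj
          simp only [hχ, chiLE_faceAt]; omega
        · refine hsep j ⟨i.1 + 1, by omega⟩ (hx2 _ (by simp only; omega) (by simp only; omega))
            ?_ hj
          simp only [hχ, chiLE_faceAt]; omega
    have hI1 : ω ⟨2 * k, by omega⟩ = m k := alternating_even le_rfl _ _ _ _
    have hI2 : ω ⟨2 * k + 1 + 2 * l, by omega⟩ = m' l := alternating_add_even _ _ _ _ _ _
    have hi' : i = ⟨2 * k, by omega⟩ ∨ i = ⟨2 * k + 1 + 2 * l, by omega⟩ := by
      simp only [Fin.ext_iff]; omega
    have hmk : m k = 1 := by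
      rcases hi' with h | h
      · rwa [h, hI1] at hi
      · rwa [h, hI2, ← hmid] at hi
    have hpair : (Finset.univ.filter fun j => SameBlock χ ω i j) =
        {⟨2 * k, by omega⟩, ⟨2 * k + 1 + 2 * l, by omega⟩} := by
      ext j
      simp only [Finset.mem_filter, Finset.mem_univ, true_and, Finset.mem_insert,
        Finset.mem_singleton]
      constructor
      · intro hj
        by_contra hne
        simp only [Fin.ext_iff] at hne hi'
        by_cases hjl : j.1 < 2 * k
        · refine hsep j ⟨2 * k - 1, by omega⟩ (hx1 _ (by simp only; omega) (by simp only; omega))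
            ?_ hj
          simp only [hχ, chiLE_faceAt]; omega
        · refine hsep j ⟨2 * k + 1 + 2 * l - 1, by omega⟩
            (hx2 _ (by simp only; omega) (by simp only; omega)) ?_ hj
          simp only [hχ, chiLE_faceAt]; omega
      · intro hj c hc
        have hc' : c = ⟨2 * k, by omega⟩ ∨ c = ⟨2 * k + 1 + 2 * l, by omega⟩ := by
          simp only [hχ, chiLE_faceAt] at hc
          simp only [Fin.ext_iff] at hi' hj ⊢; omega
        have h1 : ∀ c : Fin n, c = ⟨2 * k, by omega⟩ ∨ c = ⟨2 * k + 1 + 2 * l, by omega⟩ →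
            ω c = 1 := by
          rintro c (rfl | rfl)
          · rw [hI1, hmk]
          · rw [hI2, ← hmid, hmk]
        rw [h1 c hc', h1 i hi', h1 j hj]; simp
    rw [hpair, subProd_pair _ (by rw [Fin.lt_def]; simp only; omega)]
    have e1 : a ⟨2 * k, by omega⟩ = y k := alternating_even le_rfl _ _ _ _
    have e2 : a ⟨2 * k + 1 + 2 * l, by omega⟩ = y' l := alternating_add_even _ _ _ _ _ _
    rw [e1, e2, h1 _ (hy _) _ (hy' _), hcmid hmk]
    simp
  have main := hC n (by omega) χ ω a hmem (by
    intro V hV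
    obtain ⟨i, -, rfl⟩ := Finset.mem_image.1 hV
    rcases two (ω i) with h | h
    · exact hblock0 i h
    · exact (hblock1 i h).1)
  -- One factor of label `1` already makes the product over the blocks vanish.
  rw [main.2]
  have hex1 : ∃ i : Fin n, ω i = 1 := by
    rcases hex with ⟨i, hi, h⟩ | ⟨i, hi, h⟩
    · refine ⟨⟨2 * i, by omega⟩, ?_⟩
      simpa only [hω, alternating_even hi] using h
    · refine ⟨⟨2 * k + 1 + 2 * i, by omega⟩, ?_⟩
      simpa only [hω, alternating_add_even] using h
  obtain ⟨i, hi⟩ := hex1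
  exact Finset.prod_eq_zero (Finset.mem_image_of_mem _ (Finset.mem_univ i)) (hblock1 i hi).2

/-- A bilinear identity `Φ (P y Q y') = κ Φ (y y')` holds as soon as it holds for `y = y' = 1` and
for the pairs such that `Φ (y y') = 0`. -/
theorem bilinear_eq_of_centered (hΦ : Φ 1 = 1) {T T' : Subalgebra ℂ B} {P Q : B} {κ : ℂ}
    (hone : Φ (P * 1 * (Q * 1)) = κ)
    (hcen : ∀ y ∈ T, ∀ y' ∈ T', Φ (y * y') = 0 → Φ (P * y * (Q * y')) = 0)
    {y y' : B} (hy : y ∈ T) (hy' : y' ∈ T') :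
    Φ (P * y * (Q * y')) = κ * Φ (y * y') := by
  have halg : ∀ (R : Subalgebra ℂ B) (u : B), u ∈ R → ∀ c : ℂ, u - c • 1 ∈ R :=
    fun R u hu c => sub_mem hu (R.smul_mem (one_mem R) c)
  have hl := hcen _ (halg T y hy (Φ y)) 1 (one_mem _) (by simp [hΦ])
  have hr := hcen 1 (one_mem _) _ (halg T' y' hy' (Φ y')) (by simp [hΦ])
  -- The shifts satisfy `(c - Φ y) * (d - Φ y') = Φ y * Φ y' - Φ (y * y')`, which is exactly `Φ ((y
  -- - c) * (y' - d)) = 0`. Taking `c - Φ y = 1` avoids any division.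
  set c := Φ y + 1
  set d := Φ y' + (Φ y * Φ y' - Φ (y * y'))
  have hb := hcen _ (halg T y hy c) _ (halg T' y' hy' d) (by
    simp only [sub_mul, mul_sub, map_sub, smul_mul_assoc, mul_smul_comm, map_smul, one_mul,
      mul_one, hΦ, smul_eq_mul, c, d]
    ring)
  simp only [sub_mul, mul_sub, map_sub, smul_mul_assoc, mul_smul_comm, map_smul, mul_one,
    smul_eq_mul] at hl hr hb hone
  simp only [c, d] at hb
  linear_combination hb + (Φ y' + (Φ y * Φ y' - Φ (y * y'))) * hl + (Φ y + 1) * hr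
    + Φ (y * y') * hone

theorem getD_of_forall {α : Type*} {P : α → Prop} {l : List α} {d : α} (h : ∀ e ∈ l, P e)
    (hd : P d) (i : ℕ) : P (l.getD i d) := by
  rcases lt_or_ge i l.length with hi | hi
  · rw [List.getD_eq_getElem _ _ hi]; exact h _ (List.getElem_mem hi)
  · rwa [List.getD_eq_default _ _ hi]

/-- The moment formula when all slots but the middle ones are trivial or centered. -/
theorem CBiFree.moment_of_centered (hC : CBiFree Φ Ψ S) (hΦ : Φ 1 = 1)
    (hx : x ∈ S 0 left) (hx' : x' ∈ S 0 right)
    (h0 : ∀ L : List B, (∀ e ∈ L, e = 1 ∨ e = x ∨ e = x') → (x ∈ L ∨ x' ∈ L) → Ψ L.prod = 0)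
    (h1 : ∀ y ∈ S 1 left, ∀ y' ∈ S 1 right, Ψ (y * y') = Φ (y * y'))
    (p q : List B) (hp : ∀ e ∈ p, e ∈ S 1 left) (hq : ∀ e ∈ q, e ∈ S 1 right)
    (hpc : ∀ e ∈ p, e = 1 ∨ Φ e = 0) (hqc : ∀ e ∈ q, e = 1 ∨ Φ e = 0)
    {y y' : B} (hy : y ∈ S 1 left) (hy' : y' ∈ S 1 right) :
    Φ ((p.map (· * x)).prod * y * ((q.map (· * x')).prod * y')) =
      (p.map Φ).prod * (q.map Φ).prod * Φ (x ^ p.length * x' ^ q.length) * Φ (y * y') := by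
  classical
  have main : ∀ y ∈ S 1 left, ∀ y' ∈ S 1 right, ((y = 1 ∧ y' = 1) ∨ Φ (y * y') = 0) →
      ((∃ e ∈ p, e ≠ 1) ∨ (∃ e ∈ q, e ≠ 1) ∨ ¬ (y = 1 ∧ y' = 1)) →
      Φ ((p.map (· * x)).prod * y * ((q.map (· * x')).prod * y')) = 0 := by
    intro y hy y' hy' hyy hne
    have e : ∀ (p : List B) (x y : B), (p.map (· * x)) =
        (List.range p.length).map fun i => (if i = p.length then y else p.getD i 1) * x := by
      intro p x y
      apply List.ext_getElem
      · simp
      · intro i h h'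
        have : i < p.length := by simpa using h
        simp [this, this.ne]
    -- The index `p.length`, just past the list, holds the final slot. A slot is marked `0` when it
    -- equals `1`, but the two final slots are marked together: `0` only if both equal `1`, since
    -- they share a block.
    have := hC.alternating_eq_zero hx hx' h0 h1 p.length q.length
      (fun i => if i = p.length then y else p.getD i 1)
      (fun i => if i = q.length then y' else q.getD i 1)
      (fun i => if i = p.length then (if y = 1 ∧ y' = 1 then 0 else 1) else
        if p.getD i 1 = 1 then 0 else 1)
      (fun i => if i = q.length then (if y = 1 ∧ y' = 1 then 0 else 1) else
        if q.getD i 1 = 1 then 0 else 1) ?_ ?_ ?_ ?_ ?_ ?_ ?_ ?_ ?_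
    · rw [e p x y, e q x' y']
      simpa using this
    · intro i; split_ifs
      exacts [hy, getD_of_forall hp (one_mem _) i]
    · intro i; split_ifs
      exacts [hy', getD_of_forall hq (one_mem _) i]
    · intro i hi; split_ifs at hi ⊢ with h1 h2 h2
      exacts [h2.1, absurd hi one_ne_zero, h2, absurd hi one_ne_zero]
    · intro i hi; split_ifs at hi ⊢ with h1 h2 h2
      exacts [h2.2, absurd hi one_ne_zero, h2, absurd hi one_ne_zero]
    · intro i hik hi
      rw [if_neg hik.ne] at hi ⊢
      split_ifs at hi with h1
      · exact absurd hi zero_ne_one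
      · exact (getD_of_forall hpc (Or.inl rfl) i).resolve_left h1
    · intro i hik hi
      rw [if_neg hik.ne] at hi ⊢
      split_ifs at hi with h1
      · exact absurd hi zero_ne_one
      · exact (getD_of_forall hqc (Or.inl rfl) i).resolve_left h1
    · simp
    · simp only [if_true]
      intro hi
      split_ifs at hi with h1
      · exact absurd hi zero_ne_one
      · exact hyy.resolve_left h1
    · have hget : ∀ l : List B, (∃ e ∈ l, e ≠ 1) → ∃ i < l.length, l.getD i 1 ≠ 1 := by
        rintro l ⟨e, he, hne⟩
        obtain ⟨i, hi, rfl⟩ := List.getElem_of_mem he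
        exact ⟨i, hi, by rwa [List.getD_eq_getElem _ _ hi]⟩
      rcases hne with h | h | h
      · obtain ⟨i, hi, h⟩ := hget p h
        left; refine ⟨i, hi.le, ?_⟩; rw [if_neg hi.ne, if_neg h]
      · obtain ⟨i, hi, h⟩ := hget q h
        right; refine ⟨i, hi.le, ?_⟩; rw [if_neg hi.ne, if_neg h]
      · left; refine ⟨p.length, le_rfl, ?_⟩; rw [if_pos rfl, if_neg h]
  refine bilinear_eq_of_centered (T := S 1 left) (T' := S 1 right) hΦ ?_ ?_ hy hy'
  -- A nontrivial slot is centered and makes both sides zero. If all slots are trivial, the word is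
  -- `x ^ p.length * x' ^ q.length`.
  · by_cases hne : (∃ e ∈ p, e ≠ 1) ∨ (∃ e ∈ q, e ≠ 1)
    · rw [main 1 (one_mem _) 1 (one_mem _) (Or.inl ⟨rfl, rfl⟩) (hne.imp_right Or.inl)]
      rcases hne with ⟨e, he, hne⟩ | ⟨e, he, hne⟩
      · have : (p.map Φ).prod = 0 :=
          List.prod_eq_zero (List.mem_map.2 ⟨e, he, (hpc e he).resolve_left hne⟩)
        simp [this]
      · have : (q.map Φ).prod = 0 :=
          List.prod_eq_zero (List.mem_map.2 ⟨e, he, (hqc e he).resolve_left hne⟩)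
        simp [this]
    · push Not at hne
      rw [List.eq_replicate_of_mem hne.1, List.eq_replicate_of_mem hne.2]
      simp [hΦ]
  · intro y hy y' hy' h
    refine main y hy y' hy' (Or.inr h) (Or.inr (Or.inr ?_))
    rintro ⟨rfl, rfl⟩
    simp [hΦ] at h

/-- The moment formula: the slots are integrated out, the two last ones jointly. -/
theorem CBiFree.moment_formula (hC : CBiFree Φ Ψ S) (hΦ : Φ 1 = 1)
    (hx : x ∈ S 0 left) (hx' : x' ∈ S 0 right)
    (h0 : ∀ L : List B, (∀ e ∈ L, e = 1 ∨ e = x ∨ e = x') → (x ∈ L ∨ x' ∈ L) → Ψ L.prod = 0)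
    (h1 : ∀ y ∈ S 1 left, ∀ y' ∈ S 1 right, Ψ (y * y') = Φ (y * y'))
    (p q : List B) (hp : ∀ e ∈ p, e ∈ S 1 left) (hq : ∀ e ∈ q, e ∈ S 1 right)
    {y y' : B} (hy : y ∈ S 1 left) (hy' : y' ∈ S 1 right) :
    Φ ((p.map (· * x)).prod * y * ((q.map (· * x')).prod * y')) =
      (p.map Φ).prod * (q.map Φ).prod * Φ (x ^ p.length * x' ^ q.length) * Φ (y * y') := by
  -- Both sides are linear in each slot, and `c = (c - Φ c • 1) + Φ c • 1`. The prefix `q₁` collects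
  -- the slots already equal to `1` or centered, and `q₂` those still arbitrary.
  have right_slots : ∀ (q₂ q₁ p : List B), (∀ e ∈ p, e ∈ S 1 left) →
      (∀ e ∈ p, e = 1 ∨ Φ e = 0) → (∀ e ∈ q₁, e ∈ S 1 right) → (∀ e ∈ q₁, e = 1 ∨ Φ e = 0) →
      (∀ e ∈ q₂, e ∈ S 1 right) →
      Φ ((p.map (· * x)).prod * y * (((q₁ ++ q₂).map (· * x')).prod * y')) =
        (p.map Φ).prod * ((q₁ ++ q₂).map Φ).prod * Φ (x ^ p.length * x' ^ (q₁ ++ q₂).length) *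
          Φ (y * y') := by
    intro q₂
    induction q₂ with
    | nil =>
      intro q₁ p hp hpc hq hqc _
      simpa using hC.moment_of_centered hΦ hx hx' h0 h1 p q₁ hp hq hpc hqc hy hy'
    | cons c q₂ ih =>
      intro q₁ p hp hpc hq hqc hq₂
      have hcS := hq₂ c (by simp)
      have hq₂' : ∀ e ∈ q₂, e ∈ S 1 right := fun e he => hq₂ e (by simp [he])
      have i1 := ih (q₁ ++ [1]) p hp hpc (by simpa [or_imp, forall_and] using hq)
        (by simpa [or_imp, forall_and] using hqc) hq₂'
      have i2 := ih (q₁ ++ [c - Φ c • 1]) p hp hpc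
        (by simpa [or_imp, forall_and] using
          ⟨hq, sub_mem hcS ((S 1 right).smul_mem (one_mem _) (Φ c))⟩)
        (by
          intro e he
          rcases List.mem_append.1 he with he | he
          · exact hqc e he
          · right; rw [List.mem_singleton.1 he]; simp [hΦ]) hq₂'
      simp only [List.append_assoc, List.singleton_append, List.map_append, List.map_cons,
        List.prod_append, List.prod_cons, List.length_append, List.length_cons, sub_mul, mul_sub,
        map_sub, smul_mul_assoc, mul_smul_comm, map_smul, one_mul, smul_eq_mul, hΦ] at i1 i2 ⊢
      linear_combination i2 + Φ c * i1
  have left_slots : ∀ (p₂ p₁ : List B), (∀ e ∈ p₁, e ∈ S 1 left) →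
      (∀ e ∈ p₁, e = 1 ∨ Φ e = 0) → (∀ e ∈ p₂, e ∈ S 1 left) →
      Φ (((p₁ ++ p₂).map (· * x)).prod * y * ((q.map (· * x')).prod * y')) =
        ((p₁ ++ p₂).map Φ).prod * (q.map Φ).prod * Φ (x ^ (p₁ ++ p₂).length * x' ^ q.length) *
          Φ (y * y') := by
    intro p₂
    induction p₂ with
    | nil =>
      intro p₁ hp hpc _
      simpa using right_slots q [] p₁ hp hpc (by simp) (by simp) hq
    | cons c p₂ ih =>
      intro p₁ hp hpc hp₂
      have hcS := hp₂ c (by simp)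
      have hp₂' : ∀ e ∈ p₂, e ∈ S 1 left := fun e he => hp₂ e (by simp [he])
      have i1 := ih (p₁ ++ [1]) (by simpa [or_imp, forall_and] using hp)
        (by simpa [or_imp, forall_and] using hpc) hp₂'
      have i2 := ih (p₁ ++ [c - Φ c • 1])
        (by simpa [or_imp, forall_and] using
          ⟨hp, sub_mem hcS ((S 1 left).smul_mem (one_mem _) (Φ c))⟩)
        (by
          intro e he
          rcases List.mem_append.1 he with he | he
          · exact hpc e he
          · right; rw [List.mem_singleton.1 he]; simp [hΦ]) hp₂'
      simp only [List.append_assoc, List.singleton_append, List.map_append, List.map_cons,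
        List.prod_append, List.prod_cons, List.length_append, List.length_cons, sub_mul, mul_sub,
        map_sub, smul_mul_assoc, mul_smul_comm, map_smul, one_mul, smul_eq_mul, hΦ] at i1 i2 ⊢
      linear_combination i2 + Φ c * i1
  simpa using left_slots p [] (by simp) (by simp) hp

end Moments

end BiMonotone

namespace BiMonotone

open Face

/-! ### Expansion of powers of a sum into words -/

section Words

variable {B : Type*} [Ring B] [Algebra ℂ B]

/-- The span of the words `y^{i₁} x y^{i₂} x ⋯ y^{i_k} x y^j`. -/
def wordSpan (x y : B) : Submodule ℂ B :=
  Submodule.span ℂ {w | ∃ (p : List ℕ) (j : ℕ), w = (p.map fun i => y ^ i * x).prod * y ^ j}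

/-- The span is stable under left multiplication by `x + y`: a new `x` opens a slot of exponent `0`,
and a new `y` raises the first exponent. -/
theorem add_pow_mem_wordSpan (x y : B) (m : ℕ) : (x + y) ^ m ∈ wordSpan x y := by
  induction m with
  | zero => exact Submodule.subset_span ⟨[], 0, by simp⟩
  | succ m ih =>
    rw [pow_succ']
    generalize (x + y) ^ m = W at ih
    induction ih using Submodule.span_induction with
    | mem w hw =>
      obtain ⟨p, j, rfl⟩ := hw
      rw [add_mul]
      refine add_mem (Submodule.subset_span ⟨0 :: p, j, by simp [mul_assoc]⟩) ?_
      cases p with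
      | nil => exact Submodule.subset_span ⟨[], j + 1, by simp [pow_succ']⟩
      | cons i p => exact Submodule.subset_span ⟨(i + 1) :: p, j, by simp [pow_succ', mul_assoc]⟩
    | zero => rw [mul_zero]; exact zero_mem _
    | add v w _ _ hv hw => rw [mul_add]; exact add_mem hv hw
    | smul c w _ hw => rw [mul_smul_comm]; exact Submodule.smul_mem _ c hw

end Words

/-! ### Mixed moments of bi-monotonically independent pairs -/

section Independence

variable {A : Type*} [NonUnitalRing A] [Module ℂ A] [SMulCommClass ℂ A A] [IsScalarTower ℂ A A]

theorem unitalExt_one (φ : A →ₗ[ℂ] ℂ) : unitalExt φ 1 = 1 := by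
  simp [unitalExt]

/-- The mixed moments of the elements of bi-monotonically independent pairs of algebras. -/
theorem BiMonotonicallyIndependent.moment_formula {φ : A →ₗ[ℂ] ℂ}
    {S : Fin 2 → Face → NonUnitalSubalgebra ℂ A} (h : BiMonotonicallyIndependent φ S)
    {a₁ b₁ a₂ b₂ : A} (ha₁ : a₁ ∈ S 0 left) (hb₁ : b₁ ∈ S 0 right)
    (ha₂ : a₂ ∈ S 1 left) (hb₂ : b₂ ∈ S 1 right) (p q : List ℕ) (j n : ℕ) :
    unitalExt φ ((p.map fun i => (a₂ : Unitization ℂ A) ^ i * (a₁ : Unitization ℂ A)).prod *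
        (a₂ : Unitization ℂ A) ^ j *
      ((q.map fun i => (b₂ : Unitization ℂ A) ^ i * (b₁ : Unitization ℂ A)).prod *
        (b₂ : Unitization ℂ A) ^ n)) =
      (p.map fun i => unitalExt φ ((a₂ : Unitization ℂ A) ^ i)).prod *
      (q.map fun i => unitalExt φ ((b₂ : Unitization ℂ A) ^ i)).prod *
      unitalExt φ ((a₁ : Unitization ℂ A) ^ p.length * (b₁ : Unitization ℂ A) ^ q.length) *
      unitalExt φ ((a₂ : Unitization ℂ A) ^ j * (b₂ : Unitization ℂ A) ^ n) := by
  obtain ⟨Ψ, hP⟩ := h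
  set B : Fin 2 → Face → Type _ := fun k c => Unitization ℂ (S k c) with hB
  set Λ : FullFree B →ₐ[ℂ] Unitization ℂ A :=
    LinearAlgebra.FreeProduct.lift ℂ (fun i : Fin 2 × Face => B i.1 i.2)
      (fun {i} => Unitization.lift ((Unitization.inrNonUnitalAlgHom ℂ A).comp
        (NonUnitalSubalgebraClass.subtype (S i.1 i.2)))) with hΛ
  set inj : ∀ i : Fin 2 × Face, B i.1 i.2 →ₐ[ℂ] FullFree B := fun i =>
    LinearAlgebra.FreeProduct.ι ℂ (fun i : Fin 2 × Face => B i.1 i.2) i with hinj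
  have hΛι : ∀ (i : Fin 2 × Face) (s : S i.1 i.2),
      Λ (inj i (Unitization.inr s : B i.1 i.2)) = ((s : A) : Unitization ℂ A) := by
    intro i s
    have := DFunLike.congr_fun (LinearAlgebra.FreeProduct.lift_comp_ι ℂ
      (fun i : Fin 2 × Face => B i.1 i.2)
      (fun {i} => Unitization.lift ((Unitization.inrNonUnitalAlgHom ℂ A).comp
        (NonUnitalSubalgebraClass.subtype (S i.1 i.2)))) (i := i)) (Unitization.inr s)
    refine this.trans ?_
    simp [NonUnitalAlgHom.toAlgHom]
  set Φ : FullFree B →ₗ[ℂ] ℂ := unitalExt φ ∘ₗ Λ.toLinearMap with hΦ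
  have hC : CBiFree Φ Ψ fun k c => (inj (k, c)).range := hP.cBiFree
  have hΦ1 : Φ 1 = 1 := by simp [hΦ, unitalExt_one]
  have hpair : ∀ k c (s : B k c), inj (k, c) s =
      pairIncl B k (LinearAlgebra.FreeProduct.ι ℂ (B k) c s) := by
    intro k c s
    exact (DFunLike.congr_fun (LinearAlgebra.FreeProduct.lift_comp_ι ℂ (B k)
      (fun {c} => inj (k, c)) (i := c)) s).symm
  set x₁ : FullFree B := inj (0, left) (Unitization.inr ⟨a₁, ha₁⟩)
  set x₁' : FullFree B := inj (0, right) (Unitization.inr ⟨b₁, hb₁⟩)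
  set x₂ : FullFree B := inj (1, left) (Unitization.inr ⟨a₂, ha₂⟩)
  set x₂' : FullFree B := inj (1, right) (Unitization.inr ⟨b₂, hb₂⟩)
  -- On the first pair `Ψ` is the character `D`, so a product vanishes as soon as one factor is
  -- killed. The letters have to be lifted to the free product of the first pair, where
  -- multiplicativity is available.
  have h0 : ∀ L : List (FullFree B), (∀ e ∈ L, e = 1 ∨ e = x₁ ∨ e = x₁') →
      (x₁ ∈ L ∨ x₁' ∈ L) → Ψ L.prod = 0 := by
    set D : PairFree (B 0) →ₐ[ℂ] ℂ := LinearAlgebra.FreeProduct.lift ℂ (B 0)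
      (fun {c} => Unitization.fstHom ℂ (S 0 c)) with hD
    have hΨ : ∀ u, Ψ (pairIncl B 0 u) = D u := fun u => DFunLike.congr_fun (hP.restrict_snd 0) u
    have hDι : ∀ c (s : S 0 c),
        D (LinearAlgebra.FreeProduct.ι ℂ (B 0) c (Unitization.inr s : B 0 c)) = 0 := by
      intro c s
      have := DFunLike.congr_fun (LinearAlgebra.FreeProduct.lift_comp_ι ℂ (B 0)
        (fun {c} => Unitization.fstHom ℂ (S 0 c)) (i := c)) (Unitization.inr s)
      exact this.trans (Unitization.fst_inr ℂ s)
    have lift_list : ∀ L : List (FullFree B), (∀ e ∈ L, e = 1 ∨ e = x₁ ∨ e = x₁') →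
        ∃ L' : List (PairFree (B 0)), L'.map (pairIncl B 0) = L ∧
          ((x₁ ∈ L ∨ x₁' ∈ L) → ∃ e ∈ L', D e = 0) := by
      intro L
      induction L with
      | nil => exact fun _ => ⟨[], rfl, by simp⟩
      | cons e L ih =>
        intro hL
        obtain ⟨L', hL', hD'⟩ := ih fun e he => hL e (by simp [he])
        have hcons : ∀ u, pairIncl B 0 u = e → ((x₁ = e ∨ x₁' = e) → D u = 0) →
            ∃ L'' : List (PairFree (B 0)), L''.map (pairIncl B 0) = e :: L ∧
              ((x₁ ∈ e :: L ∨ x₁' ∈ e :: L) → ∃ e ∈ L'', D e = 0) := by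
          intro u hu hDu
          refine ⟨u :: L', by rw [List.map_cons, hu, hL'], fun hmem => ?_⟩
          simp only [List.mem_cons] at hmem
          by_cases hue : x₁ = e ∨ x₁' = e
          · exact ⟨u, by simp, hDu hue⟩
          · obtain ⟨t, ht, htD⟩ := hD' (by tauto)
            exact ⟨t, by simp [ht], htD⟩
        -- Testing for a letter before testing for `1` ensures that a letter is always lifted to a
        -- generator killed by `D`, without proving it distinct from `1`.
        by_cases hue : x₁ = e ∨ x₁' = e
        · rcases hue with h | h
          · exact hcons _ ((hpair _ _ _).symm.trans h) fun _ => hDι _ _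
          · exact hcons _ ((hpair _ _ _).symm.trans h) fun _ => hDι _ _
        · rcases hL e (by simp) with h | h | h
          · exact hcons 1 (by rw [map_one, h]) fun h => absurd h hue
          · exact absurd (Or.inl h.symm) hue
          · exact absurd (Or.inr h.symm) hue
    intro L hL hx
    obtain ⟨L', rfl, hL'⟩ := lift_list L hL
    obtain ⟨e, he, hDe⟩ := hL' hx
    rw [← map_list_prod, hΨ, map_list_prod]
    exact List.prod_eq_zero (List.mem_map.2 ⟨e, he, hDe⟩)
  -- Both coordinates of the c-bi-free product restrict to the same functional on the second pair.
  have h1 : ∀ y ∈ (inj (1, left)).range, ∀ y' ∈ (inj (1, right)).range,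
      Ψ (y * y') = Φ (y * y') := by
    rintro _ ⟨s, rfl⟩ _ ⟨t, rfl⟩
    have e1 := DFunLike.congr_fun (hP.restrict_fst 1)
      (LinearAlgebra.FreeProduct.ι ℂ (B 1) left s * LinearAlgebra.FreeProduct.ι ℂ (B 1) right t)
    have e2 := DFunLike.congr_fun (hP.restrict_snd 1)
      (LinearAlgebra.FreeProduct.ι ℂ (B 1) left s * LinearAlgebra.FreeProduct.ι ℂ (B 1) right t)
    rw [if_neg one_ne_zero, ← e1] at e2
    change Ψ (inj (1, left) s * inj (1, right) t) = Φ (inj (1, left) s * inj (1, right) t)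
    rw [hpair, hpair, ← map_mul]
    exact e2
  have key := hC.moment_formula hΦ1 (x := x₁) (x' := x₁')
    (AlgHom.mem_range_self _ _) (AlgHom.mem_range_self _ _) h0 h1
    (p.map (x₂ ^ ·)) (q.map (x₂' ^ ·))
    (by
      simp only [List.mem_map]; rintro _ ⟨i, -, rfl⟩
      exact pow_mem (AlgHom.mem_range_self _ _) i)
    (by
      simp only [List.mem_map]; rintro _ ⟨i, -, rfl⟩
      exact pow_mem (AlgHom.mem_range_self _ _) i) (y := x₂ ^ j) (y' := x₂' ^ n)
    (pow_mem (AlgHom.mem_range_self _ _) j) (pow_mem (AlgHom.mem_range_self _ _) n)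
  have e1 : Λ x₁ = a₁ := hΛι _ _
  have e2 : Λ x₁' = b₁ := hΛι _ _
  have e3 : Λ x₂ = a₂ := hΛι _ _
  have e4 : Λ x₂' = b₂ := hΛι _ _
  simpa [hΦ, map_list_prod, List.map_map, Function.comp_def, e1, e2, e3, e4] using key

variable {φ : A →ₗ[ℂ] ℂ} {a₁ b₁ a₂ b₂ : A}

theorem BiMonotonicPairs.moment_formula (h : BiMonotonicPairs φ a₁ b₁ a₂ b₂) (p q : List ℕ)
    (j n : ℕ) :
    unitalExt φ ((p.map fun i => (a₂ : Unitization ℂ A) ^ i * (a₁ : Unitization ℂ A)).prod *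
        (a₂ : Unitization ℂ A) ^ j *
      ((q.map fun i => (b₂ : Unitization ℂ A) ^ i * (b₁ : Unitization ℂ A)).prod *
        (b₂ : Unitization ℂ A) ^ n)) =
      (p.map fun i => unitalExt φ ((a₂ : Unitization ℂ A) ^ i)).prod *
      (q.map fun i => unitalExt φ ((b₂ : Unitization ℂ A) ^ i)).prod *
      unitalExt φ ((a₁ : Unitization ℂ A) ^ p.length * (b₁ : Unitization ℂ A) ^ q.length) *
      unitalExt φ ((a₂ : Unitization ℂ A) ^ j * (b₂ : Unitization ℂ A) ^ n) := by
  refine BiMonotonicallyIndependent.moment_formula h ?_ ?_ ?_ ?_ p q j n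
  all_goals exact NonUnitalAlgebra.subset_adjoin ℂ rfl

/-- After both powers of sums are expanded into words, the moment formulas for the two sides differ
only in the slot `i`, which contributes its own moment. The prefix `a₁ ^ k` is a run of `k` slots of
exponent `0`. -/
theorem BiMonotonicPairs.left_slot (h : BiMonotonicPairs φ a₁ b₁ a₂ b₂) (k i m n : ℕ) :
    unitalExt φ ((a₁ : Unitization ℂ A) ^ k * ((a₂ : Unitization ℂ A) ^ i * (a₁ *
      (a₁ + a₂ : Unitization ℂ A) ^ m)) * (b₁ + b₂ : Unitization ℂ A) ^ n) =
    unitalExt φ ((a₂ : Unitization ℂ A) ^ i) * unitalExt φ ((a₁ : Unitization ℂ A) ^ (k + 1) *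
      (a₁ + a₂ : Unitization ℂ A) ^ m * (b₁ + b₂ : Unitization ℂ A) ^ n) := by
  generalize hW : (a₁ + a₂ : Unitization ℂ A) ^ m = W
  generalize hW' : (b₁ + b₂ : Unitization ℂ A) ^ n = W'
  have mW : W ∈ wordSpan (a₁ : Unitization ℂ A) a₂ := hW ▸ add_pow_mem_wordSpan _ _ _
  have mW' : W' ∈ wordSpan (b₁ : Unitization ℂ A) b₂ := hW' ▸ add_pow_mem_wordSpan _ _ _
  clear hW hW'
  induction mW using Submodule.span_induction with
  | mem w hw =>
    obtain ⟨p, j, rfl⟩ := hw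
    induction mW' using Submodule.span_induction with
    | mem w hw =>
      obtain ⟨q, n, rfl⟩ := hw
      have h1 := h.moment_formula (List.replicate k 0 ++ i :: p) q j n
      have h2 := h.moment_formula (List.replicate (k + 1) 0 ++ p) q j n
      simp only [List.map_append, List.map_cons, List.map_replicate, List.prod_append,
        List.prod_cons, List.prod_replicate, pow_zero, one_mul, unitalExt_one, one_pow,
        List.length_append, List.length_replicate, List.length_cons, mul_assoc] at h1 h2 ⊢
      rw [h1, h2, show k + (p.length + 1) = k + 1 + p.length by ring]
    | zero => simp
    | add v w _ _ hv hw => rw [mul_add, mul_add, map_add, map_add, hv, hw]; ring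
    | smul c w _ hw =>
      rw [mul_smul_comm, mul_smul_comm, map_smul, map_smul, hw, smul_eq_mul, smul_eq_mul]; ring
  | zero => simp
  | add v w _ _ hv hw => simp only [mul_add, add_mul, map_add, hv, hw]
  | smul c w _ hw =>
    simp only [mul_smul_comm, smul_mul_assoc, map_smul, hw, smul_eq_mul]; ring

/-- The right analogue, in the form needed once the left face has been reduced to `a₁ ^ k * a₂ ^ j`.
-/
theorem BiMonotonicPairs.right_slot (h : BiMonotonicPairs φ a₁ b₁ a₂ b₂) (k j l i n : ℕ) :
    unitalExt φ ((a₁ : Unitization ℂ A) ^ k * (a₂ : Unitization ℂ A) ^ j *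
      ((b₁ : Unitization ℂ A) ^ l * ((b₂ : Unitization ℂ A) ^ i * (b₁ *
        (b₁ + b₂ : Unitization ℂ A) ^ n)))) =
    unitalExt φ ((b₂ : Unitization ℂ A) ^ i) *
      unitalExt φ ((a₁ : Unitization ℂ A) ^ k * (a₂ : Unitization ℂ A) ^ j *
        ((b₁ : Unitization ℂ A) ^ (l + 1) * (b₁ + b₂ : Unitization ℂ A) ^ n)) := by
  generalize hW' : (b₁ + b₂ : Unitization ℂ A) ^ n = W'
  have mW' : W' ∈ wordSpan (b₁ : Unitization ℂ A) b₂ := hW' ▸ add_pow_mem_wordSpan _ _ _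
  clear hW'
  induction mW' using Submodule.span_induction with
  | mem w hw =>
    obtain ⟨q, n, rfl⟩ := hw
    have h1 := h.moment_formula (List.replicate k 0) (List.replicate l 0 ++ i :: q) j n
    have h2 := h.moment_formula (List.replicate k 0) (List.replicate (l + 1) 0 ++ q) j n
    simp only [List.map_append, List.map_cons, List.map_replicate, List.prod_append,
      List.prod_cons, List.prod_replicate, pow_zero, one_mul, unitalExt_one, one_pow,
      List.length_append, List.length_replicate, List.length_cons, mul_assoc] at h1 h2 ⊢
    rw [h1, h2, show l + (q.length + 1) = l + 1 + q.length by ring]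
  | zero => simp
  | add v w _ _ hv hw => simp only [mul_add, map_add, hv, hw]
  | smul c w _ hw =>
    simp only [mul_smul_comm, map_smul, hw, smul_eq_mul]; ring

theorem BiMonotonicPairs.moment_pow (h : BiMonotonicPairs φ a₁ b₁ a₂ b₂) (k j l n : ℕ) :
    unitalExt φ ((a₁ : Unitization ℂ A) ^ k * (a₂ : Unitization ℂ A) ^ j *
      ((b₁ : Unitization ℂ A) ^ l * (b₂ : Unitization ℂ A) ^ n)) =
    unitalExt φ ((a₁ : Unitization ℂ A) ^ k * (b₁ : Unitization ℂ A) ^ l) *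
      unitalExt φ ((a₂ : Unitization ℂ A) ^ j * (b₂ : Unitization ℂ A) ^ n) := by
  simpa [unitalExt_one] using h.moment_formula (List.replicate k 0) (List.replicate l 0) j n

end Independence

end BiMonotone

namespace BiMonotone

/-! ### Formal evaluation of series and the renewal equation -/

section SeriesEval

variable {σ R : Type*} [CommRing R]

/-- The value `∑ₘ fₘ uᵐ` at a power series `u` without constant term. -/
noncomputable def seriesEval (u : MvPowerSeries σ R) (f : ℕ → MvPowerSeries σ R) :
    MvPowerSeries σ R :=
  MvPowerSeries.formalSum fun m => f m * u ^ m

/-- The order of `u ^ m` is at least `m`. This makes the formal sums locally finite and lets every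
identity below be checked on truncations. -/
theorem coeff_mul_eq_zero_of_pow {u : MvPowerSeries σ R} (hu : u.constantCoeff = 0)
    (f : MvPowerSeries σ R) {m : ℕ} {d : σ →₀ ℕ} (hd : d.degree < m) :
    MvPowerSeries.coeff d (f * u ^ m) = 0 := by
  apply MvPowerSeries.coeff_of_lt_order
  calc (d.degree : ℕ∞) < m := by exact_mod_cast hd
    _ ≤ (u ^ m).order := MvPowerSeries.le_order_pow_of_constantCoeff_eq_zero m hu
    _ ≤ f.order + (u ^ m).order := le_add_self
    _ ≤ _ := MvPowerSeries.le_order_mul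

theorem coeff_seriesEval {u : MvPowerSeries σ R} (hu : u.constantCoeff = 0)
    (f : ℕ → MvPowerSeries σ R) {N : ℕ} {d : σ →₀ ℕ} (hd : d.degree < N) :
    MvPowerSeries.coeff d (seriesEval u f) =
      MvPowerSeries.coeff d (∑ m ∈ Finset.range N, f m * u ^ m) := by
  rw [map_sum]
  change ∑ᶠ m, MvPowerSeries.coeff d (f m * u ^ m) = _
  apply finsum_eq_sum_of_support_subset
  intro m hm
  by_contra hmN
  simp only [Finset.coe_range, Set.mem_Iio, not_lt] at hmN
  exact hm (coeff_mul_eq_zero_of_pow hu _ (hd.trans_le hmN))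

theorem seriesEval_add {u : MvPowerSeries σ R} (hu : u.constantCoeff = 0)
    (f g : ℕ → MvPowerSeries σ R) :
    seriesEval u (fun m => f m + g m) = seriesEval u f + seriesEval u g := by
  ext d
  rw [map_add, coeff_seriesEval hu _ d.degree.lt_succ_self,
    coeff_seriesEval hu _ d.degree.lt_succ_self, coeff_seriesEval hu _ d.degree.lt_succ_self,
    ← map_add, ← Finset.sum_add_distrib]
  simp only [add_mul]

theorem coeff_mul_congr {f g : MvPowerSeries σ R} {N : ℕ}
    (h : ∀ d : σ →₀ ℕ, d.degree < N → MvPowerSeries.coeff d f = MvPowerSeries.coeff d g)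
    (c : MvPowerSeries σ R) {d : σ →₀ ℕ} (hd : d.degree < N) :
    MvPowerSeries.coeff d (f * c) = MvPowerSeries.coeff d (g * c) := by
  classical
  rw [MvPowerSeries.coeff_mul, MvPowerSeries.coeff_mul]
  refine Finset.sum_congr rfl fun p hp => ?_
  rw [h p.1]
  rw [← Finset.HasAntidiagonal.mem_antidiagonal.1 hp, map_add] at hd
  omega

theorem seriesEval_mul_right {u : MvPowerSeries σ R} (hu : u.constantCoeff = 0)
    (f : ℕ → MvPowerSeries σ R) (c : MvPowerSeries σ R) :
    seriesEval u (fun m => f m * c) = seriesEval u f * c := by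
  ext d
  rw [coeff_seriesEval hu _ d.degree.lt_succ_self,
    coeff_mul_congr (fun e he => coeff_seriesEval hu f he) c d.degree.lt_succ_self, Finset.sum_mul]
  simp only [mul_right_comm]

theorem seriesEval_mul_left {u : MvPowerSeries σ R} (hu : u.constantCoeff = 0)
    (c : MvPowerSeries σ R) (f : ℕ → MvPowerSeries σ R) :
    seriesEval u (fun m => c * f m) = c * seriesEval u f := by
  simpa only [mul_comm c] using seriesEval_mul_right hu f c

theorem seriesEval_sum {u : MvPowerSeries σ R} (hu : u.constantCoeff = 0) {ι : Type*}
    (s : Finset ι) (f : ι → ℕ → MvPowerSeries σ R) :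
    seriesEval u (fun m => ∑ i ∈ s, f i m) = ∑ i ∈ s, seriesEval u (f i) := by
  ext d
  rw [map_sum, coeff_seriesEval hu _ d.degree.lt_succ_self]
  simp only [coeff_seriesEval hu _ d.degree.lt_succ_self, ← map_sum, Finset.sum_mul]
  rw [Finset.sum_comm]

theorem seriesEval_succ {u : MvPowerSeries σ R} (hu : u.constantCoeff = 0)
    (f : ℕ → MvPowerSeries σ R) :
    seriesEval u f = f 0 + seriesEval u (fun m => f (m + 1)) * u := by
  ext d
  have hd : d.degree < d.degree + 1 + 1 := by omega
  rw [coeff_seriesEval hu _ hd, map_add,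
    coeff_mul_congr (fun e he => coeff_seriesEval hu _ he) u d.degree.lt_succ_self,
    Finset.sum_range_succ', Finset.sum_mul, ← map_add, add_comm]
  simp [pow_succ, mul_assoc]

theorem seriesEval_zero (f : ℕ → MvPowerSeries σ R) : seriesEval 0 f = f 0 := by
  rw [seriesEval_succ (map_zero _), mul_zero, add_zero]

/-- If `F - ∑_{m < N} fₘ uᵐ` is divisible by `u^N` for all `N`, then `F = ∑ₘ fₘ uᵐ`. -/
theorem eq_seriesEval {u : MvPowerSeries σ R} (hu : u.constantCoeff = 0)
    {f : ℕ → MvPowerSeries σ R} {F : MvPowerSeries σ R}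
    (h : ∀ N, ∃ r, F = ∑ m ∈ Finset.range N, f m * u ^ m + r * u ^ N) : F = seriesEval u f := by
  ext d
  obtain ⟨r, hr⟩ := h (d.degree + 1)
  rw [coeff_seriesEval hu _ d.degree.lt_succ_self, hr, map_add,
    coeff_mul_eq_zero_of_pow hu r d.degree.lt_succ_self, add_zero]

/-- Compares the triangle `i + j < N` with the square, whose remaining terms are zero; for series
these are the terms of too high order. -/
theorem sum_range_antidiagonal {M : Type*} [AddCommMonoid M] {N : ℕ} (t : ℕ → ℕ → M)
    (ht : ∀ i j, N ≤ i + j → t i j = 0) :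
    ∑ n ∈ Finset.range N, ∑ p ∈ Finset.HasAntidiagonal.antidiagonal n, t p.1 p.2 =
      ∑ i ∈ Finset.range N, ∑ j ∈ Finset.range N, t i j := by
  rw [← Finset.sum_product' (Finset.range N) (Finset.range N) t,
    ← Finset.sum_filter_add_sum_filter_not _ (fun p : ℕ × ℕ => p.1 + p.2 < N),
    Finset.sum_eq_zero (s := Finset.filter (fun p : ℕ × ℕ => ¬ p.1 + p.2 < N) _), add_zero,
    ← Finset.sum_fiberwise_of_maps_to (g := fun p : ℕ × ℕ => p.1 + p.2) (t := Finset.range N)]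
  · refine Finset.sum_congr rfl fun n hn => Finset.sum_congr ?_ fun _ _ => rfl
    ext p
    simp only [Finset.HasAntidiagonal.mem_antidiagonal, Finset.mem_filter, Finset.mem_product, Finset.mem_range]
      at hn ⊢
    omega
  · intro p hp
    simpa using (Finset.mem_filter.1 hp).2
  · intro p hp
    exact ht _ _ (not_lt.1 (Finset.mem_filter.1 hp).2)

theorem seriesEval_mul {u : MvPowerSeries σ R} (hu : u.constantCoeff = 0)
    (f g : ℕ → MvPowerSeries σ R) :
    seriesEval u (fun m => ∑ p ∈ Finset.HasAntidiagonal.antidiagonal m, f p.1 * g p.2) =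
      seriesEval u f * seriesEval u g := by
  ext d
  have hd := d.degree.lt_succ_self
  rw [coeff_seriesEval hu _ hd, coeff_mul_congr (fun e he => coeff_seriesEval hu _ he) _ hd,
    mul_comm, coeff_mul_congr (fun e he => coeff_seriesEval hu _ he) _ hd, mul_comm,
    Finset.sum_mul_sum]
  simp only [map_sum]
  rw [← sum_range_antidiagonal]
  · refine Finset.sum_congr rfl fun n _ => ?_
    rw [Finset.sum_mul, map_sum]
    refine Finset.sum_congr rfl fun p hp => ?_
    rw [← Finset.HasAntidiagonal.mem_antidiagonal.1 hp]
    congr 1; ring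
  · intro i j hij
    rw [show f i * u ^ i * (g j * u ^ j) = f i * g j * u ^ (i + j) by ring]
    exact coeff_mul_eq_zero_of_pow hu _ (by omega)

/-- The solution of a renewal recursion, in terms of generating series. -/
theorem seriesEval_renewal {u : MvPowerSeries σ R} (hu : u.constantCoeff = 0)
    {α β : ℕ → ℕ → MvPowerSeries σ R} {γ : ℕ → MvPowerSeries σ R}
    (h0 : ∀ k, α k 0 = β k 0)
    (hs : ∀ k m, α k (m + 1) =
      β k (m + 1) + ∑ p ∈ Finset.HasAntidiagonal.antidiagonal m, γ p.1 * α (k + 1) p.2) :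
    seriesEval u (α 0) = seriesEval (u * seriesEval u γ) fun k => seriesEval u (β k) := by
  have step : ∀ k, seriesEval u (α k) =
      seriesEval u (β k) + seriesEval u (α (k + 1)) * (u * seriesEval u γ) := by
    intro k
    rw [seriesEval_succ hu (α k), seriesEval_succ hu (β k), h0 k]
    simp only [hs k]
    rw [seriesEval_add hu, seriesEval_mul hu]
    ring
  refine eq_seriesEval (by rw [map_mul, hu, zero_mul]) fun N => ⟨seriesEval u (α N), ?_⟩
  induction N with
  | zero => simp
  | succ N ih => rw [ih, step N, Finset.sum_range_succ]; ring

/-- The value `∑ e m n uᵐ vⁿ` at a pair of power series without constant term. -/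
noncomputable def biEval (u v : MvPowerSeries σ R) (e : ℕ → ℕ → R) : MvPowerSeries σ R :=
  seriesEval u fun m => seriesEval v fun n => MvPowerSeries.C (e m n)

theorem biEval_zero_right (u : MvPowerSeries σ R) (e : ℕ → ℕ → R) :
    biEval u 0 e = seriesEval u fun m => MvPowerSeries.C (e m 0) := by
  simp only [biEval, seriesEval_zero]

theorem biEval_zero_left (v : MvPowerSeries σ R) (e : ℕ → ℕ → R) :
    biEval 0 v e = seriesEval v fun n => MvPowerSeries.C (e 0 n) := by
  simp only [biEval, seriesEval_zero]

theorem coeff_biEval {u v : MvPowerSeries σ R} (hu : u.constantCoeff = 0)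
    (hv : v.constantCoeff = 0) (e : ℕ → ℕ → R) {N : ℕ} {d : σ →₀ ℕ} (hd : d.degree < N) :
    MvPowerSeries.coeff d (biEval u v e) =
      MvPowerSeries.coeff d (∑ m ∈ Finset.range N, ∑ n ∈ Finset.range N,
        MvPowerSeries.C (e m n) * (u ^ m * v ^ n)) := by
  rw [biEval, coeff_seriesEval hu _ hd, map_sum, map_sum]
  refine Finset.sum_congr rfl fun m _ => ?_
  rw [coeff_mul_congr (fun e he => coeff_seriesEval hv _ he) _ hd, Finset.sum_mul]
  congr 1
  refine Finset.sum_congr rfl fun n _ => ?_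
  ring

theorem coeff_pow_mul_pow_eq_zero {u v : MvPowerSeries σ R} (hu : u.constantCoeff = 0)
    (hv : v.constantCoeff = 0) (c : MvPowerSeries σ R) {m n : ℕ} {d : σ →₀ ℕ}
    (hd : d.degree < m + n) : MvPowerSeries.coeff d (c * (u ^ m * v ^ n)) = 0 := by
  apply MvPowerSeries.coeff_of_lt_order
  calc (d.degree : ℕ∞) < m + n := by exact_mod_cast hd
    _ ≤ (u ^ m).order + (v ^ n).order := add_le_add
        (MvPowerSeries.le_order_pow_of_constantCoeff_eq_zero m hu)
        (MvPowerSeries.le_order_pow_of_constantCoeff_eq_zero n hv)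
    _ ≤ (u ^ m * v ^ n).order := MvPowerSeries.le_order_mul
    _ ≤ c.order + (u ^ m * v ^ n).order := le_add_self
    _ ≤ _ := MvPowerSeries.le_order_mul

/-- The double series, summed along the antidiagonals. -/
theorem biEval_mul_eq_formalSum_antidiagonal {u v : MvPowerSeries σ R}
    (hu : u.constantCoeff = 0) (hv : v.constantCoeff = 0) (e : ℕ → ℕ → R)
    (c : MvPowerSeries σ R) :
    biEval u v e * c = MvPowerSeries.formalSum fun n : ℕ =>
      ∑ p ∈ Finset.HasAntidiagonal.antidiagonal n, MvPowerSeries.C (e p.1 p.2) * (u ^ p.1 * v ^ p.2 * c) := by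
  ext d
  have hd := d.degree.lt_succ_self
  have hz : ∀ i j, d.degree + 1 ≤ i + j →
      MvPowerSeries.coeff d (MvPowerSeries.C (e i j) * (u ^ i * v ^ j * c)) = 0 := by
    intro i j hij
    rw [show MvPowerSeries.C (e i j) * (u ^ i * v ^ j * c) =
      MvPowerSeries.C (e i j) * c * (u ^ i * v ^ j) by ring]
    exact coeff_pow_mul_pow_eq_zero hu hv _ (by omega)
  rw [coeff_mul_congr (fun e' he => coeff_biEval hu hv e he) c hd, Finset.sum_mul]
  simp only [Finset.sum_mul, map_sum, mul_assoc]
  simp only [mul_assoc] at hz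
  rw [← sum_range_antidiagonal _ hz]
  change _ = ∑ᶠ n : ℕ, MvPowerSeries.coeff d (∑ p ∈ Finset.HasAntidiagonal.antidiagonal n, _)
  rw [finsum_eq_sum_of_support_subset (s := Finset.range (d.degree + 1))]
  · simp only [map_sum]
  · intro n hn
    by_contra hnN
    simp only [Finset.coe_range, Set.mem_Iio, not_lt] at hnN
    refine hn ?_
    simp only [map_sum]
    refine Finset.sum_eq_zero fun p hp => ?_
    exact hz _ _ (by rw [Finset.HasAntidiagonal.mem_antidiagonal.1 hp]; exact hnN)

/-- The double series as a sum over pairs of exponents. -/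
theorem biEval_mul_eq_formalSum_prod {u v : MvPowerSeries σ R}
    (hu : u.constantCoeff = 0) (hv : v.constantCoeff = 0) (e : ℕ → ℕ → R)
    (c : MvPowerSeries σ R) :
    biEval u v e * c = MvPowerSeries.formalSum fun p : ℕ × ℕ =>
      MvPowerSeries.C (e p.1 p.2) * (u ^ p.1 * v ^ p.2 * c) := by
  ext d
  have hd := d.degree.lt_succ_self
  rw [coeff_mul_congr (fun e' he => coeff_biEval hu hv e he) c hd, Finset.sum_mul]
  simp only [Finset.sum_mul, map_sum, mul_assoc]
  change _ = ∑ᶠ p : ℕ × ℕ, MvPowerSeries.coeff d _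
  rw [finsum_eq_sum_of_support_subset
      (s := Finset.range (d.degree + 1) ×ˢ Finset.range (d.degree + 1)), Finset.sum_product]
  · intro p hp
    by_contra hpN
    simp only [Finset.coe_product, Finset.coe_range, Set.mem_prod, Set.mem_Iio] at hpN
    refine hp ?_
    simp only [← mul_assoc (u ^ p.1)]
    rw [show MvPowerSeries.C (e p.1 p.2) * (u ^ p.1 * v ^ p.2 * c) =
      MvPowerSeries.C (e p.1 p.2) * c * (u ^ p.1 * v ^ p.2) by ring]
    exact coeff_pow_mul_pow_eq_zero hu hv _ (by omega)

end SeriesEval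

/-! ### The convolution identity for moment series -/

section Convolution

/-- Sorts the words by the position of their first `x`; the isolated term is the word without `x`.
-/
theorem add_pow_succ_eq {B : Type*} [Semiring B] (x y : B) (m : ℕ) :
    (x + y) ^ (m + 1) =
      y ^ (m + 1) + ∑ p ∈ Finset.HasAntidiagonal.antidiagonal m, y ^ p.1 * (x * (x + y) ^ p.2) := by
  induction m with
  | zero => simp [add_comm]
  | succ m ih =>
    rw [Finset.Nat.sum_antidiagonal_succ, pow_succ' _ (m + 1), add_mul]
    nth_rw 2 [ih]
    simp only [pow_succ' y, pow_zero, one_mul, mul_assoc, ← Finset.mul_sum, mul_add]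
    abel

variable {σ A : Type*} [NonUnitalRing A] [Module ℂ A] [SMulCommClass ℂ A A] [IsScalarTower ℂ A A]
  {φ : A →ₗ[ℂ] ℂ} {a₁ b₁ a₂ b₂ : A}

/-- The convolution formula for the generating series of the moments. -/
theorem BiMonotonicPairs.biEval_moment (h : BiMonotonicPairs φ a₁ b₁ a₂ b₂)
    {u v : MvPowerSeries σ ℂ} (hu : u.constantCoeff = 0) (hv : v.constantCoeff = 0) :
    biEval u v (moment φ (a₁ + a₂) (b₁ + b₂)) =
      biEval (u * seriesEval u fun i => MvPowerSeries.C (unitalExt φ ((a₂ : Unitization ℂ A) ^ i)))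
        (v * seriesEval v fun i => MvPowerSeries.C (unitalExt φ ((b₂ : Unitization ℂ A) ^ i)))
        (moment φ a₁ b₁) * biEval u v (moment φ a₂ b₂) := by
  set E := unitalExt φ
  set U := u * seriesEval u fun i => MvPowerSeries.C (E ((a₂ : Unitization ℂ A) ^ i)) with hU
  set V := v * seriesEval v fun i => MvPowerSeries.C (E ((b₂ : Unitization ℂ A) ^ i)) with hV
  have hU0 : U.constantCoeff = 0 := by rw [hU, map_mul, hu, zero_mul]
  have hV0 : V.constantCoeff = 0 := by rw [hV, map_mul, hv, zero_mul]
  -- Renewal in the left variable: `k` counts the letters `a₁` already moved to the front, each of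
  -- which has released a slot of powers of `a₂`. The right face is carried along untouched.
  have left : biEval u v (moment φ (a₁ + a₂) (b₁ + b₂)) =
      seriesEval U fun k => seriesEval u fun m => seriesEval v fun n =>
        MvPowerSeries.C (E ((a₁ : Unitization ℂ A) ^ k * (a₂ : Unitization ℂ A) ^ m *
          (b₁ + b₂ : Unitization ℂ A) ^ n)) := by
    have := seriesEval_renewal hu
      (α := fun k m => seriesEval v fun n =>
        MvPowerSeries.C (E ((a₁ : Unitization ℂ A) ^ k * (a₁ + a₂ : Unitization ℂ A) ^ m *
          (b₁ + b₂ : Unitization ℂ A) ^ n)))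
      (β := fun k m => seriesEval v fun n =>
        MvPowerSeries.C (E ((a₁ : Unitization ℂ A) ^ k * (a₂ : Unitization ℂ A) ^ m *
          (b₁ + b₂ : Unitization ℂ A) ^ n)))
      (γ := fun i => MvPowerSeries.C (E ((a₂ : Unitization ℂ A) ^ i))) (by simp) (by
        intro k m
        simp only [← seriesEval_mul_left hv]
        rw [← seriesEval_sum hv, ← seriesEval_add hv]
        congr 1
        funext n
        simp only [← map_mul, ← map_sum, ← map_add]
        congr 1
        rw [add_pow_succ_eq, mul_add, add_mul, map_add, Finset.mul_sum, Finset.sum_mul, map_sum]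
        simp only [E, h.left_slot])
    rw [← this, biEval]
    simp [moment, E]
  have right : ∀ k m, (seriesEval v fun n =>
        MvPowerSeries.C (E ((a₁ : Unitization ℂ A) ^ k * (a₂ : Unitization ℂ A) ^ m *
          (b₁ + b₂ : Unitization ℂ A) ^ n))) =
      seriesEval V fun l => seriesEval v fun n =>
        MvPowerSeries.C (E ((a₁ : Unitization ℂ A) ^ k * (a₂ : Unitization ℂ A) ^ m *
          ((b₁ : Unitization ℂ A) ^ l * (b₂ : Unitization ℂ A) ^ n))) := by
    intro k m
    have := seriesEval_renewal hv
      (α := fun l n =>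
        MvPowerSeries.C (E ((a₁ : Unitization ℂ A) ^ k * (a₂ : Unitization ℂ A) ^ m *
          ((b₁ : Unitization ℂ A) ^ l * (b₁ + b₂ : Unitization ℂ A) ^ n))))
      (β := fun l n =>
        MvPowerSeries.C (E ((a₁ : Unitization ℂ A) ^ k * (a₂ : Unitization ℂ A) ^ m *
          ((b₁ : Unitization ℂ A) ^ l * (b₂ : Unitization ℂ A) ^ n))))
      (γ := fun i => MvPowerSeries.C (E ((b₂ : Unitization ℂ A) ^ i))) (by simp) (by
        intro l n
        simp only [← map_mul, ← map_sum, ← map_add]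
        congr 1
        rw [add_pow_succ_eq, mul_add, mul_add, map_add, Finset.mul_sum, Finset.mul_sum, map_sum]
        simp only [E, h.right_slot])
    rw [← this]
    simp
  -- Only moments of `a₁ ^ k * a₂ ^ m * (b₁ ^ l * b₂ ^ n)` remain. They factor by `moment_pow`, and
  -- so does the fourfold series.
  rw [left]
  simp only [right, E, h.moment_pow, map_mul, seriesEval_mul_left hv, seriesEval_mul_right hV0,
    seriesEval_mul_left hu, seriesEval_mul_right hU0]
  rfl

end Convolution

end BiMonotone

namespace BiMonotone

/-! ### Cauchy transforms in terms of moment series -/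

section Transforms

variable {σ A : Type*} [NonUnitalRing A] [Module ℂ A] [SMulCommClass ℂ A A] [IsScalarTower ℂ A A]
  {φ : A →ₗ[ℂ] ℂ} {a b a₁ b₁ a₂ b₂ : A}

theorem toSeries_algebraMap {p : MvPowerSeries σ ℂ} (hp : p.constantCoeff = 0) :
    toSeries (algebraMap (MvPowerSeries σ ℂ) (FormalField σ) p) = p := by
  have h : ∃ q : MvPowerSeries σ ℂ, MvPowerSeries.constantCoeff q = 0 ∧
      algebraMap (MvPowerSeries σ ℂ) (FormalField σ) q = algebraMap _ _ p := ⟨p, hp, rfl⟩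
  rw [toSeries, dif_pos h]
  exact IsFractionRing.injective _ _ h.choose_spec.2

theorem biEval_moment_zero_right (u : MvPowerSeries σ ℂ) : biEval u 0 (moment φ a b) =
    seriesEval u fun i => MvPowerSeries.C (unitalExt φ ((a : Unitization ℂ A) ^ i)) := by
  simp [biEval_zero_right, moment]

theorem biEval_moment_zero_left (v : MvPowerSeries σ ℂ) : biEval 0 v (moment φ a b) =
    seriesEval v fun i => MvPowerSeries.C (unitalExt φ ((b : Unitization ℂ A) ^ i)) := by
  simp [biEval_zero_left, moment]

theorem biEval_moment_ne_zero {u v : MvPowerSeries σ ℂ} (hu : u.constantCoeff = 0)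
    (hv : v.constantCoeff = 0) : biEval u v (moment φ a b) ≠ 0 := by
  intro h
  have : (biEval u v (moment φ a b)).constantCoeff = 1 := by
    rw [biEval, seriesEval_succ hu, seriesEval_succ hv]
    simp [hu, hv, moment, unitalExt_one]
  rw [h, map_zero] at this
  exact zero_ne_one this

theorem BiMonotonicPairs.biEval_eq (h : BiMonotonicPairs φ a₁ b₁ a₂ b₂)
    {u v : MvPowerSeries σ ℂ} (hu : u.constantCoeff = 0) (hv : v.constantCoeff = 0) :
    biEval u v (moment φ (a₁ + a₂) (b₁ + b₂)) =
      biEval (biEval u 0 (moment φ a₂ b₂) * u) (biEval 0 v (moment φ a₂ b₂) * v)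
        (moment φ a₁ b₁) * biEval u v (moment φ a₂ b₂) := by
  rw [h.biEval_moment hu hv, biEval_moment_zero_right, biEval_moment_zero_left, mul_comm u,
    mul_comm v]

theorem seriesEval_C_mul_eq_formalSum {u : MvPowerSeries σ ℂ} (hu : u.constantCoeff = 0)
    (e : ℕ → ℂ) : (seriesEval u fun m => MvPowerSeries.C (e m)) * u =
      MvPowerSeries.formalSum fun m => MvPowerSeries.C (e m) * u ^ (m + 1) := by
  rw [← seriesEval_mul_right hu, seriesEval]
  congr 1
  funext m
  ring

/-- At second argument `0` the joint series forgets `b`, so `b` may be chosen freely; this lets the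
one-variable transforms be read off from the two-variable identity. -/
theorem cauchy_eq {Z : FormalField σ} {u : MvPowerSeries σ ℂ} (hu : u.constantCoeff = 0)
    (hZ : Z⁻¹ = algebraMap _ _ u) (b : A) :
    cauchy φ a Z = algebraMap _ _ (biEval u 0 (moment φ a b) * u) := by
  rw [cauchy, hZ, toSeries_algebraMap hu, biEval_zero_right, seriesEval_C_mul_eq_formalSum hu]
  simp [MvPowerSeries.smul_eq_C_mul, moment]

theorem cauchy_eq' {Z : FormalField σ} {v : MvPowerSeries σ ℂ} (hv : v.constantCoeff = 0)
    (hZ : Z⁻¹ = algebraMap _ _ v) (a : A) :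
    cauchy φ b Z = algebraMap _ _ (biEval 0 v (moment φ a b) * v) := by
  rw [cauchy_eq hv hZ 0, biEval_moment_zero_right, biEval_moment_zero_left]

theorem cauchy₂_eq {Z W : FormalField σ} {u v : MvPowerSeries σ ℂ} (hu : u.constantCoeff = 0)
    (hv : v.constantCoeff = 0) (hZ : Z⁻¹ = algebraMap _ _ u) (hW : W⁻¹ = algebraMap _ _ v) :
    cauchy₂ φ a b Z W = algebraMap _ _ (biEval u v (moment φ a b) * (u * v)) := by
  rw [cauchy₂, hZ, hW, toSeries_algebraMap hu, toSeries_algebraMap hv,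
    biEval_mul_eq_formalSum_prod hu hv]
  congr 2
  funext p
  rw [MvPowerSeries.smul_eq_C_mul]
  ring

/-- The scalar power series, as power series over the unitization. -/
noncomputable abbrev scalarSeries (σ A : Type*) [NonUnitalRing A] [Module ℂ A]
    [SMulCommClass ℂ A A] [IsScalarTower ℂ A A] :
    MvPowerSeries σ ℂ →+* MvPowerSeries σ (Unitization ℂ A) :=
  MvPowerSeries.map (algebraMap ℂ (Unitization ℂ A))

theorem scalarSeries_mul_C (p : MvPowerSeries σ ℂ) (x : Unitization ℂ A) :
    scalarSeries σ A p * MvPowerSeries.C x = MvPowerSeries.C x * scalarSeries σ A p := by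
  ext1 d
  rw [MvPowerSeries.coeff_mul_C, MvPowerSeries.coeff_C_mul, MvPowerSeries.coeff_map]
  exact Algebra.commutes _ _

/-- Scalars are central, so the noncommutative words and the scalar series can be collected
separately, although the coefficient algebra is not commutative. -/
theorem C_mul_scalarSeries_mul (p q : MvPowerSeries σ ℂ) (x y : Unitization ℂ A) :
    MvPowerSeries.C x * scalarSeries σ A p * (MvPowerSeries.C y * scalarSeries σ A q) =
      MvPowerSeries.C (x * y) * scalarSeries σ A (p * q) := by
  rw [mul_assoc, ← mul_assoc (scalarSeries σ A p), scalarSeries_mul_C, map_mul, map_mul]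
  simp only [mul_assoc]

theorem mapFunctional_C_mul (p : MvPowerSeries σ ℂ) (x : Unitization ℂ A) :
    mapFunctional φ (MvPowerSeries.C x * scalarSeries σ A p) =
      MvPowerSeries.C (unitalExt φ x) * p := by
  ext d
  rw [MvPowerSeries.coeff_C_mul]
  change unitalExt φ (MvPowerSeries.coeff d _) = _
  rw [MvPowerSeries.coeff_C_mul, MvPowerSeries.coeff_map, ← Algebra.commutes, ← Algebra.smul_def,
    map_smul, smul_eq_mul, mul_comm]

theorem mapFunctional_sum {ι : Type*} (s : Finset ι)
    (f : ι → MvPowerSeries σ (Unitization ℂ A)) :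
    mapFunctional φ (∑ i ∈ s, f i) = ∑ i ∈ s, mapFunctional φ (f i) := by
  ext d
  rw [map_sum]
  change unitalExt φ (MvPowerSeries.coeff d _) = _
  rw [map_sum, map_sum]
  rfl

/-- A path from the first to the second index uses the corner `s` exactly once, with `p.1` letters
`a` before it and `p.2` letters `b` after it. Hence the corner involves precisely the moments of the
form $a^ib^j$. -/
theorem resolvent_term (a b : A) (u v s : MvPowerSeries σ ℂ) (n : ℕ) :
    !![scalarSeries σ A u, scalarSeries σ A s; 0, scalarSeries σ A v] *
      ((!![a, 0; 0, b].map fun x => MvPowerSeries.C (x : Unitization ℂ A)) *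
        !![scalarSeries σ A u, scalarSeries σ A s; 0, scalarSeries σ A v]) ^ n =
    !![MvPowerSeries.C ((a : Unitization ℂ A) ^ n) * scalarSeries σ A (u ^ (n + 1)),
      ∑ p ∈ Finset.HasAntidiagonal.antidiagonal n,
        MvPowerSeries.C ((a : Unitization ℂ A) ^ p.1 * (b : Unitization ℂ A) ^ p.2) *
          scalarSeries σ A (u ^ p.1 * v ^ p.2 * s);
      0, MvPowerSeries.C ((b : Unitization ℂ A) ^ n) * scalarSeries σ A (v ^ (n + 1))] := by
  have hX : (!![a, 0; 0, b].map fun x => MvPowerSeries.C (x : Unitization ℂ A)) *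
      !![scalarSeries σ A u, scalarSeries σ A s; 0, scalarSeries σ A v] =
      !![MvPowerSeries.C (a : Unitization ℂ A) * scalarSeries σ A u,
        MvPowerSeries.C (a : Unitization ℂ A) * scalarSeries σ A s;
        0, MvPowerSeries.C (b : Unitization ℂ A) * scalarSeries σ A v] := by
    ext i j : 1
    fin_cases i <;> fin_cases j <;> simp [Matrix.mul_apply, Fin.sum_univ_two]
  rw [hX]
  induction n with
  | zero => simp
  | succ n ih =>
    have h01 : MvPowerSeries.C ((a : Unitization ℂ A) ^ n) * scalarSeries σ A (u ^ (n + 1)) *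
          (MvPowerSeries.C (a : Unitization ℂ A) * scalarSeries σ A s) +
        (∑ p ∈ Finset.HasAntidiagonal.antidiagonal n,
          MvPowerSeries.C ((a : Unitization ℂ A) ^ p.1 * (b : Unitization ℂ A) ^ p.2) *
            scalarSeries σ A (u ^ p.1 * v ^ p.2 * s)) *
          (MvPowerSeries.C (b : Unitization ℂ A) * scalarSeries σ A v) =
        ∑ p ∈ Finset.HasAntidiagonal.antidiagonal (n + 1),
          MvPowerSeries.C ((a : Unitization ℂ A) ^ p.1 * (b : Unitization ℂ A) ^ p.2) *
            scalarSeries σ A (u ^ p.1 * v ^ p.2 * s) := by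
      -- The term with no `b` comes from taking `s` in the new factor; all other terms gain one `b`
      -- and one `v`.
      rw [Finset.Nat.sum_antidiagonal_succ', Finset.sum_mul]
      simp only [C_mul_scalarSeries_mul, pow_zero, mul_one, ← pow_succ]
      congr 1
      refine Finset.sum_congr rfl fun p _ => ?_
      rw [pow_succ (b : Unitization ℂ A), pow_succ v]
      congr 2
      · rw [mul_assoc]
      · ring
    rw [pow_succ, ← mul_assoc, ih, Matrix.mul_fin_two, h01]
    simp only [C_mul_scalarSeries_mul, mul_zero, zero_mul, add_zero, zero_add, ← pow_succ]

/-- The matrix-valued Cauchy transform of a diagonal matrix at an upper triangular matrix. -/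
theorem matCauchy_eq {B : Matrix (Fin 2) (Fin 2) (FormalField σ)} {u v s : MvPowerSeries σ ℂ}
    (hu : u.constantCoeff = 0) (hv : v.constantCoeff = 0) (hs : s.constantCoeff = 0)
    (hB : B⁻¹ = !![algebraMap _ _ u, algebraMap _ _ s; 0, algebraMap _ _ v]) :
    matCauchy φ !![a, 0; 0, b] B =
      !![algebraMap _ _ (biEval u 0 (moment φ a b) * u),
          algebraMap _ _ (biEval u v (moment φ a b) * s);
        0, algebraMap _ _ (biEval 0 v (moment φ a b) * v)] := by
  have h0 : toSeries (0 : FormalField σ) = 0 := by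
    rw [← map_zero (algebraMap (MvPowerSeries σ ℂ) (FormalField σ))]
    exact toSeries_algebraMap (map_zero _)
  have hC : B⁻¹.map (fun x => scalarSeries σ A (toSeries x)) =
      !![scalarSeries σ A u, scalarSeries σ A s; 0, scalarSeries σ A v] := by
    rw [hB]
    ext i j : 1
    fin_cases i <;> fin_cases j <;> simp [toSeries_algebraMap, hu, hv, hs, h0]
  have hz : mapFunctional φ (0 : MvPowerSeries σ (Unitization ℂ A)) = 0 := by
    simpa using mapFunctional_sum (φ := φ) (∅ : Finset ℕ)
      (fun _ => (0 : MvPowerSeries σ (Unitization ℂ A)))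
  simp only [matCauchy]
  rw [hC]
  simp only [resolvent_term]
  have h00 : (MvPowerSeries.formalSum fun _ : ℕ => (0 : MvPowerSeries σ ℂ)) = 0 := by
    ext d
    change ∑ᶠ _ : ℕ, MvPowerSeries.coeff d (0 : MvPowerSeries σ ℂ) = _
    simp
  ext i j : 1
  fin_cases i <;> fin_cases j
  · change algebraMap _ _ (MvPowerSeries.formalSum fun n : ℕ => mapFunctional φ
      (MvPowerSeries.C ((a : Unitization ℂ A) ^ n) * scalarSeries σ A (u ^ (n + 1)))) =
      algebraMap _ _ (biEval u 0 (moment φ a b) * u)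
    simp only [mapFunctional_C_mul]
    rw [biEval_moment_zero_right, seriesEval_C_mul_eq_formalSum hu]
  · change algebraMap _ _ (MvPowerSeries.formalSum fun n : ℕ => mapFunctional φ
      (∑ p ∈ Finset.HasAntidiagonal.antidiagonal n,
        MvPowerSeries.C ((a : Unitization ℂ A) ^ p.1 * (b : Unitization ℂ A) ^ p.2) *
          scalarSeries σ A (u ^ p.1 * v ^ p.2 * s))) =
      algebraMap _ _ (biEval u v (moment φ a b) * s)
    simp only [mapFunctional_sum, mapFunctional_C_mul]
    rw [biEval_mul_eq_formalSum_antidiagonal hu hv]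
    rfl
  · change algebraMap _ _ (MvPowerSeries.formalSum fun n : ℕ => mapFunctional φ
      (0 : MvPowerSeries σ (Unitization ℂ A))) = (0 : FormalField σ)
    rw [hz, h00, map_zero]
  · change algebraMap _ _ (MvPowerSeries.formalSum fun n : ℕ => mapFunctional φ
      (MvPowerSeries.C ((b : Unitization ℂ A) ^ n) * scalarSeries σ A (v ^ (n + 1)))) =
      algebraMap _ _ (biEval 0 v (moment φ a b) * v)
    simp only [mapFunctional_C_mul]
    rw [biEval_moment_zero_left, seriesEval_C_mul_eq_formalSum hv]

theorem series_X_ne_zero (i : σ) : (MvPowerSeries.X i : MvPowerSeries σ ℂ) ≠ 0 := by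
  intro h
  have := MvPowerSeries.coeff_index_single_self_X (R := ℂ) i
  rw [h, map_zero] at this
  exact zero_ne_one this

theorem var_ne_zero (i : σ) : (var i : FormalField σ) ≠ 0 := by
  rw [var, Ne, map_eq_zero_iff _ (IsFractionRing.injective _ _)]
  exact series_X_ne_zero i

end Transforms

end BiMonotone

/-! ### The scalar and matrix-valued convolution formulas -/

theorem mainTheorem3 {A : Type*} [NonUnitalRing A] [Module ℂ A] [SMulCommClass ℂ A A]
    [IsScalarTower ℂ A A] (φ : A →ₗ[ℂ] ℂ) (a₁ b₁ a₂ b₂ : A)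
    (h : BiMonotone.BiMonotonicPairs φ a₁ b₁ a₂ b₂) :
    -- the convolution formula, in the fraction field of `ℂ[[1/z, 1/w]]`
    (∀ z w : BiMonotone.FormalField (Fin 2),
      z = (BiMonotone.var 0)⁻¹ → w = (BiMonotone.var 1)⁻¹ →
      BiMonotone.cauchy₂ φ (a₁ + a₂) (b₁ + b₂) z w =
          BiMonotone.cauchy₂ φ a₁ b₁ (BiMonotone.recCauchy φ a₂ z) (BiMonotone.recCauchy φ b₂ w) *
            BiMonotone.cauchy₂ φ a₂ b₂ z w *
            BiMonotone.recCauchy φ a₂ z * BiMonotone.recCauchy φ b₂ w ∧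
        BiMonotone.recCauchy φ (a₁ + a₂) z =
          BiMonotone.recCauchy φ a₁ (BiMonotone.recCauchy φ a₂ z) ∧
        BiMonotone.recCauchy φ (b₁ + b₂) w =
          BiMonotone.recCauchy φ b₁ (BiMonotone.recCauchy φ b₂ w)) ∧
    -- the composition of the matrix-valued transforms, over the fraction field of
    -- `ℂ[[1/z, 1/w, ζ]]`
    (∀ z w ζ : BiMonotone.FormalField (Fin 3),
      z = (BiMonotone.var 0)⁻¹ → w = (BiMonotone.var 1)⁻¹ → ζ = BiMonotone.var 2 →
      BiMonotone.matRecCauchy φ (!![a₁, 0; 0, b₁] + !![a₂, 0; 0, b₂]) !![z, ζ; 0, w] =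
        BiMonotone.matRecCauchy φ !![a₁, 0; 0, b₁]
          (BiMonotone.matRecCauchy φ !![a₂, 0; 0, b₂] !![z, ζ; 0, w])) := by
  open BiMonotone in
  constructor
  · rintro z w rfl rfl
    have hu : (MvPowerSeries.X 0 : MvPowerSeries (Fin 2) ℂ).constantCoeff = 0 :=
      MvPowerSeries.constantCoeff_X 0
    have hv : (MvPowerSeries.X 1 : MvPowerSeries (Fin 2) ℂ).constantCoeff = 0 :=
      MvPowerSeries.constantCoeff_X 1
    have hz : ((var 0 : FormalField (Fin 2))⁻¹)⁻¹ =
        algebraMap (MvPowerSeries (Fin 2) ℂ) _ (MvPowerSeries.X 0) :=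
      inv_inv _
    have hw : ((var 1 : FormalField (Fin 2))⁻¹)⁻¹ =
        algebraMap (MvPowerSeries (Fin 2) ℂ) _ (MvPowerSeries.X 1) :=
      inv_inv _
    have hu' : (MvPowerSeries.X 0 : MvPowerSeries (Fin 2) ℂ) ≠ 0 := series_X_ne_zero 0
    have hv' : (MvPowerSeries.X 1 : MvPowerSeries (Fin 2) ℂ) ≠ 0 := series_X_ne_zero 1
    generalize (var 0 : FormalField (Fin 2))⁻¹ = z at hz ⊢
    generalize (var 1 : FormalField (Fin 2))⁻¹ = w at hw ⊢
    generalize (MvPowerSeries.X 0 : MvPowerSeries (Fin 2) ℂ) = u at *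
    generalize (MvPowerSeries.X 1 : MvPowerSeries (Fin 2) ℂ) = v at *
    set U := biEval u 0 (moment φ a₂ b₂) * u with hU
    set V := biEval 0 v (moment φ a₂ b₂) * v with hV
    have hU0 : U.constantCoeff = 0 := by rw [hU, map_mul, hu, mul_zero]
    have hV0 : V.constantCoeff = 0 := by rw [hV, map_mul, hv, mul_zero]
    have hUne : algebraMap (MvPowerSeries (Fin 2) ℂ) (FormalField (Fin 2)) U ≠ 0 := by
      rw [Ne, map_eq_zero_iff _ (IsFractionRing.injective _ _)]
      exact mul_ne_zero (biEval_moment_ne_zero hu (map_zero _)) hu'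
    have hVne : algebraMap (MvPowerSeries (Fin 2) ℂ) (FormalField (Fin 2)) V ≠ 0 := by
      rw [Ne, map_eq_zero_iff _ (IsFractionRing.injective _ _)]
      exact mul_ne_zero (biEval_moment_ne_zero (map_zero _) hv) hv'
    have eU : cauchy φ a₂ z = algebraMap _ _ U := cauchy_eq hu hz b₂
    have eV : cauchy φ b₂ w = algebraMap _ _ V := cauchy_eq' hv hw a₂
    have hZ : (recCauchy φ a₂ z)⁻¹ = algebraMap _ _ U := by rw [recCauchy, inv_inv, eU]
    have hW : (recCauchy φ b₂ w)⁻¹ = algebraMap _ _ V := by rw [recCauchy, inv_inv, eV]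
    refine ⟨?_, ?_, ?_⟩
    -- The first transform on the right contributes an extra `U * V`, which the factors
    -- $F_{a_2}(z)F_{b_2}(w)$ cancel.
    · rw [cauchy₂_eq hu hv hz hw, cauchy₂_eq hU0 hV0 hZ hW, cauchy₂_eq hu hv hz hw,
        h.biEval_eq hu hv, ← hU, ← hV, recCauchy, recCauchy, eU, eV]
      simp only [map_mul] at hUne hVne ⊢
      field_simp
    -- The convolution identity at `v = 0`: its last factor times `u` is `U` itself, which completes
    -- the outer Cauchy transform.
    · rw [recCauchy, recCauchy, cauchy_eq hu hz (b₁ + b₂), cauchy_eq hU0 hZ b₁,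
        h.biEval_eq hu (map_zero _), mul_zero, mul_assoc]
    · rw [recCauchy, recCauchy, cauchy_eq' hv hw (a₁ + a₂), cauchy_eq' hV0 hW a₁,
        h.biEval_eq (map_zero _) hv, mul_zero, mul_assoc]
  · rintro z w ζ rfl rfl rfl
    set u : MvPowerSeries (Fin 3) ℂ := MvPowerSeries.X 0 with hudef
    set v : MvPowerSeries (Fin 3) ℂ := MvPowerSeries.X 1 with hvdef
    -- The corner of the inverse of the given triangular matrix is $-\zeta/(zw)$.
    set s : MvPowerSeries (Fin 3) ℂ := -(MvPowerSeries.X 2 * (u * v)) with hsdef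
    have hu : u.constantCoeff = 0 := MvPowerSeries.constantCoeff_X 0
    have hv : v.constantCoeff = 0 := MvPowerSeries.constantCoeff_X 1
    have hs : s.constantCoeff = 0 := by simp [hsdef, hu]
    have hB : (!![(var 0)⁻¹, var 2; 0, (var 1)⁻¹] :
        Matrix (Fin 2) (Fin 2) (FormalField (Fin 3)))⁻¹ =
        !![algebraMap _ _ u, algebraMap _ _ s; 0, algebraMap _ _ v] := by
      apply Matrix.inv_eq_right_inv
      have h0 := var_ne_zero (0 : Fin 3)
      have h1 := var_ne_zero (1 : Fin 3)
      rw [hsdef, map_neg, map_mul, map_mul]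
      change _ * !![var 0, -(var 2 * (var 0 * var 1)); 0, var 1] = 1
      ext i j : 1
      fin_cases i <;> fin_cases j <;> simp [Matrix.mul_apply, Fin.sum_univ_two, h0, h1]
      field_simp
      ring
    have hX : (!![a₁, 0; 0, b₁] + !![a₂, 0; 0, b₂] : Matrix (Fin 2) (Fin 2) A) =
        !![a₁ + a₂, 0; 0, b₁ + b₂] := by
      simp
    set U := biEval u 0 (moment φ a₂ b₂) * u with hU
    set V := biEval 0 v (moment φ a₂ b₂) * v with hV
    set T := biEval u v (moment φ a₂ b₂) * s with hT
    have hU0 : U.constantCoeff = 0 := by rw [hU, map_mul, hu, mul_zero]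
    have hV0 : V.constantCoeff = 0 := by rw [hV, map_mul, hv, mul_zero]
    have hT0 : T.constantCoeff = 0 := by rw [hT, map_mul, hs, mul_zero]
    have hUne : algebraMap (MvPowerSeries (Fin 3) ℂ) (FormalField (Fin 3)) U ≠ 0 := by
      rw [Ne, map_eq_zero_iff _ (IsFractionRing.injective _ _)]
      exact mul_ne_zero (biEval_moment_ne_zero hu (map_zero _)) (series_X_ne_zero 0)
    have hVne : algebraMap (MvPowerSeries (Fin 3) ℂ) (FormalField (Fin 3)) V ≠ 0 := by
      rw [Ne, map_eq_zero_iff _ (IsFractionRing.injective _ _)]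
      exact mul_ne_zero (biEval_moment_ne_zero (map_zero _) hv) (series_X_ne_zero 1)
    have e2 : (matRecCauchy φ !![a₂, 0; 0, b₂] !![(var 0)⁻¹, var 2; 0, (var 1)⁻¹])⁻¹ =
        !![algebraMap (MvPowerSeries (Fin 3) ℂ) (FormalField (Fin 3)) U, algebraMap _ _ T;
          0, algebraMap _ _ V] := by
      rw [matRecCauchy, matCauchy_eq hu hv hs hB, ← hU, ← hV, ← hT]
      apply Matrix.nonsing_inv_nonsing_inv
      rw [Matrix.det_fin_two_of, mul_zero, sub_zero]
      exact (mul_ne_zero hUne hVne).isUnit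
    -- Entrywise comparison of Cauchy transforms: the diagonal is the scalar case, and the corner is
    -- the full convolution identity multiplied by `s`.
    rw [hX, matRecCauchy, matRecCauchy, matCauchy_eq hu hv hs hB, matCauchy_eq hU0 hV0 hT0 e2,
      h.biEval_eq hu hv, h.biEval_eq hu (map_zero _), h.biEval_eq (map_zero _) hv]
    simp only [mul_zero, mul_assoc, ← hU, ← hV, ← hT]
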